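/- Let $e_1,\dots,e_7$ be seven symbols (the imaginary octonion units) and write $\bar e_i=-e_i$. Consider the signed permutations of $\{\pm e_1,\dots,\pm e_7\}$ $$\gamma: e_1\leftrightarrow -e_4,\ e_2\leftrightarrow -e_5,\ e_3\mapsto -e_3,\ e_6\mapsto e_6,\ e_7\mapsto -e_7,\qquad \theta=(e_1\bar e_5)(e_2\bar e_3e_4\bar e_7\bar e_2e_3\bar e_4e_7)(e_6\bar e_6),$$ $$A=(e_1\bar e_7e_3\bar e_1e_7\bar e_3)(e_2\bar e_4e_6)(\bar e_2e_4\bar e_6)(e_5\bar e_5),\qquad B=(e_1)(e_2\bar e_6\bar e_2e_6)(e_3\bar e_5\bar e_3e_5)(e_4)(e_7).$$ Let $E\cong 2^3$ be the group generated by the diagonal sign changes $N_1=(1,1,1,-1,-1,-1,-1)$, $N_2=(1,-1,-1,1,-1,-1,1)$, $N_7=(-1,1,-1,1,-1,1,-1)$. Denote by $4\cdot S_4{:}2$ the group generated by $\gamma,\theta$, and by $2^3\cdot S_4$ the group generated by $A,B$. Denote by $4{:}S_4{:}2$ and $2^3{:}S_4$, respectively, the semidirect products of $E$ by the group of automorphisms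 of $E$ that $4\cdot S_4{:}2$, respectively $2^3\cdot S_4$, induces on $E$ by conjugation. Then the following hold. (1) All four groups have order $192$. Both $4\cdot S_4{:}2$ and $2^3\cdot S_4$ contain $E$ as a normal subgroup, and the group of automorphisms that each induces on $E$ by conjugation is isomorphic to $S_4$. The groups $4\cdot S_4{:}2$ and $2^3\cdot S_4$ are non-split extensions, and the groups $4{:}S_4{:}2$ and $2^3{:}S_4$ are split extensions, of an elementary abelian group $2^3$ with quotient $S_4$. Moreover each of $4\cdot S_4{:}2$ and $4{:}S_4{:}2$ has normal subgroups $V\le H$ such that $V$ is a Klein four-group, $H/V\cong S_4$, and $H$ has a complement of order $2$; here $V$ has no complement in $H$ in the case of $4\cdot S_4{:}2$, and it has one in the case of $4{:}S_4{:}2$. (2) The groups $4\cdot S_4{:}2$ and $4{:}S_4{:}2$ have the same character table over $\mathbb C$. They have exactly $14$ conjugacy classes and $14$ irreducible characters; the class sizes, the orders of the elements in the classes of each group, and the character values are $$\begin{array}{l|rrrrrrrrrrrrrr} \text{class} & C_{1} & C_{2} & C_{3} & C_{4} & C_{5} & C_{6} & C_{7} & C_{8} & C_{9} & C_{10} & C_{11}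 & C_{12} & C_{13} & C_{14}\\ \text{order in }4\cdot S_4{:}2 & 1 & 2 & 2 & 2 & 2 & 2 & 3 & 4 & 4 & 4 & 4 & 6 & 8 & 8\\ \text{order in }4{:}S_4{:}2 & 1 & 2 & 2 & 4 & 4 & 4 & 3 & 2 & 2 & 2 & 2 & 6 & 4 & 4\\ \text{size} & 1 & 3 & 4 & 12 & 12 & 12 & 32 & 12 & 6 & 6 & 12 & 32 & 24 & 24\\ \hline \chi^{[1]} & 1 & 1 & 1 & 1 & 1 & 1 & 1 & 1 & 1 & 1 & 1 & 1 & 1 & 1\\ \chi^{[1_1]} & 1 & 1 & -1 & 1 & -1 & -1 & 1 & 1 & 1 & 1 & -1 & -1 & 1 & -1\\ \chi^{[1_2]} & 1 & 1 & -1 & -1 & 1 & -1 & 1 & -1 & 1 & 1 & 1 & -1 & -1 & 1\\ \chi^{[1_3]} & 1 & 1 & 1 & -1 & -1 & 1 & 1 & -1 & 1 & 1 & -1 & 1 & -1 & -1\\ \chi^{[2_1]} & 2 & 2 & -2 & 0 & 0 & -2 & -1 & 0 & 2 & 2 & 0 & 1 & 0 & 0\\ \chi^{[2_2]} & 2 &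 2 & 2 & 0 & 0 & 2 & -1 & 0 & 2 & 2 & 0 & -1 & 0 & 0\\ \chi^{[3_1]} & 3 & 3 & 3 & -1 & -1 & -1 & 0 & -1 & -1 & -1 & -1 & 0 & 1 & 1\\ \chi^{[3_2]} & 3 & 3 & 3 & 1 & 1 & -1 & 0 & 1 & -1 & -1 & 1 & 0 & -1 & -1\\ \chi^{[3_3]} & 3 & 3 & -3 & 1 & -1 & 1 & 0 & 1 & -1 & -1 & -1 & 0 & -1 & 1\\ \chi^{[3_4]} & 3 & 3 & -3 & -1 & 1 & 1 & 0 & -1 & -1 & -1 & 1 & 0 & 1 & -1\\ \chi^{[6_1]} & 6 & -2 & 0 & 0 & -2 & 0 & 0 & 0 & -2 & 2 & 2 & 0 & 0 & 0\\ \chi^{[6_2]} & 6 & -2 & 0 & 0 & 2 & 0 & 0 & 0 & -2 & 2 & -2 & 0 & 0 & 0\\ \chi^{[6_3]} & 6 & -2 & 0 & -2 & 0 & 0 & 0 & 2 & 2 & -2 & 0 & 0 & 0 & 0\\ \chi^{[6_4]} & 6 & -2 & 0 & 2 & 0 & 0 & 0 & -2 & 2 & -2 & 0 & 0 & 0 &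 0\\ \end{array}$$ (3) The groups $2^3\cdot S_4$ and $2^3{:}S_4$ have the same character table over $\mathbb C$. They have exactly $13$ conjugacy classes and $13$ irreducible characters; the class sizes, the orders of the elements in the classes of each group, and the character values are $$\begin{array}{l|rrrrrrrrrrrrr} \text{class} & C_{1} & C_{2} & C_{3} & C_{4} & C_{5} & C_{6} & C_{7} & C_{8} & C_{9} & C_{10} & C_{11} & C_{12} & C_{13}\\ \text{order in }2^3\cdot S_4 & 1 & 2 & 2 & 2 & 2 & 3 & 4 & 4 & 4 & 4 & 6 & 8 & 8\\ \text{order in }2^3{:}S_4 & 1 & 2 & 2 & 4 & 4 & 3 & 2 & 2 & 2 & 2 & 6 & 4 & 4\\ \text{size} & 1 & 1 & 6 & 12 & 24 & 32 & 6 & 6 & 12 & 12 & 32 & 24 & 24\\ \hline \chi^{[1]} & 1 & 1 & 1 & 1 & 1 & 1 & 1 & 1 & 1 & 1 & 1 & 1 & 1\\ \chi^{[1_1]} & 1 & 1 & 1 & 1 & -1 & 1 & 1 & 1 & -1 & -1 & 1 & -1 & -1\\ \chi^{[2]} & 2 & 2 & 2 & 2 & 0 & -1 & 2 & 2 & 0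 & 0 & -1 & 0 & 0\\ \chi^{[3_1]} & 3 & 3 & -1 & -1 & -1 & 0 & -1 & 3 & 1 & 1 & 0 & -1 & 1\\ \chi^{[3_2]} & 3 & 3 & -1 & -1 & 1 & 0 & -1 & 3 & -1 & -1 & 0 & 1 & -1\\ \chi^{[3_3]} & 3 & 3 & 3 & -1 & 1 & 0 & -1 & -1 & 1 & 1 & 0 & -1 & -1\\ \chi^{[3_4]} & 3 & 3 & -1 & -1 & -1 & 0 & 3 & -1 & 1 & 1 & 0 & 1 & -1\\ \chi^{[3_5]} & 3 & 3 & -1 & -1 & 1 & 0 & 3 & -1 & -1 & -1 & 0 & -1 & 1\\ \chi^{[3_6]} & 3 & 3 & 3 & -1 & -1 & 0 & -1 & -1 & -1 & -1 & 0 & 1 & 1\\ \chi^{[4_1]} & 4 & -4 & 0 & 0 & 0 & 1 & 0 & 0 & -2 & 2 & -1 & 0 & 0\\ \chi^{[4_2]} & 4 & -4 & 0 & 0 & 0 & 1 & 0 & 0 & 2 & -2 & -1 & 0 & 0\\ \chi^{[6]} & 6 & 6 & -2 & 2 & 0 & 0 & -2 & -2 & 0 & 0 & 0 & 0 & 0\\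 \chi^{[8]} & 8 & -8 & 0 & 0 & 0 & -1 & 0 & 0 & 0 & 0 & 1 & 0 & 0\\ \end{array}$$ (4) $4\cdot S_4{:}2\not\cong 4{:}S_4{:}2$ and $2^3\cdot S_4\not\cong 2^3{:}S_4$. -/

import Mathlib

namespace OctonionExtensions

/-- The signed permutation `± e_i ↦ ± s_i e_{σ i}` of the fourteen octonionic units
`± e_1, …, ± e_7`, where `s_i = -1` exactly for `i ∈ M`.  The unit `± e_i` is the pair `(±1, i)`;
indices are read modulo `7`, so that `e_7` has index `(7 : Fin 7) = 0`. -/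
def signedPerm (σ : Equiv.Perm (Fin 7)) (M : Finset (Fin 7)) : Equiv.Perm (ℤˣ × Fin 7) where
  toFun x := (x.1 * (if x.2 ∈ M then -1 else 1), σ x.2)
  invFun y := (y.1 * (if σ.symm y.2 ∈ M then -1 else 1), σ.symm y.2)
  left_inv x := by
    ext
    · simp only [Equiv.symm_apply_apply, mul_assoc]
      split <;> simp
    · simp
  right_inv y := by
    ext
    · simp only [mul_assoc]
      split <;> simp
    · simp

open Equiv in
/-- `γ : e₁ ↔ -e₄, e₂ ↔ -e₅, e₃ ↦ -e₃, e₆ ↦ e₆, e₇ ↦ -e₇`. -/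
def γ : Perm (ℤˣ × Fin 7) := signedPerm (swap 1 4 * swap 2 5) {1, 2, 3, 4, 5, 7}

open Equiv in
/-- `θ = (e₁ ē₅)(e₂ ē₃ e₄ ē₇ ē₂ e₃ ē₄ e₇)(e₆ ē₆)`, that is `e₁ ↔ -e₅`, `e₂ ↦ -e₃`, `e₃ ↦ -e₄`,
`e₄ ↦ -e₇`, `e₇ ↦ e₂`, `e₆ ↦ -e₆`. -/
def θ : Perm (ℤˣ × Fin 7) :=
  signedPerm (c[1, 5] * c[2, 3, 4, 7]) {1, 2, 3, 4, 5, 6}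

open Equiv in
/-- `A = (e₁ ē₇ e₃ ē₁ e₇ ē₃)(e₂ ē₄ e₆)(ē₂ e₄ ē₆)(e₅ ē₅)`, that is `e₁ ↦ -e₇`, `e₇ ↦ -e₃`,
`e₃ ↦ -e₁`, `e₂ ↦ -e₄`, `e₄ ↦ -e₆`, `e₆ ↦ e₂`, `e₅ ↦ -e₅`. -/
def A : Perm (ℤˣ × Fin 7) :=
  signedPerm (c[1, 7, 3] * c[2, 4, 6]) {1, 2, 3, 4, 5, 7}

open Equiv in
/-- `B = (e₂ ē₆ ē₂ e₆)(e₃ ē₅ ē₃ e₅)`, that is `e₂ ↦ -e₆`, `e₆ ↦ e₂`, `e₃ ↦ -e₅`, `e₅ ↦ e₃`,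
and `e₁, e₄, e₇` are fixed. -/
def B : Perm (ℤˣ × Fin 7) := signedPerm (swap 2 6 * swap 3 5) {2, 3}

/-- The elementary abelian group of order `8` generated by the diagonal sign changes
`N₁ = (1,1,1,-1,-1,-1,-1)`, `N₂ = (1,-1,-1,1,-1,-1,1)`, `N₇ = (-1,1,-1,1,-1,1,-1)`. -/
def E : Subgroup (Equiv.Perm (ℤˣ × Fin 7)) :=
  Subgroup.closure
    {signedPerm 1 {4, 5, 6, 7}, signedPerm 1 {2, 3, 5, 6}, signedPerm 1 {1, 3, 5, 7}}

/-- The group `4.S₄:2`, generated by `γ` and `θ`. -/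
def fourS4Two : Subgroup (Equiv.Perm (ℤˣ × Fin 7)) := Subgroup.closure {γ, θ}

/-- The group `2³.S₄`, generated by `A` and `B`. -/
def eightS4 : Subgroup (Equiv.Perm (ℤˣ × Fin 7)) := Subgroup.closure {A, B}

/-- The group of automorphisms `N ↦ g N g⁻¹` of `E` induced by the elements `g ∈ G`
(that normalize `E`). -/
def inducedAut (G : Subgroup (Equiv.Perm (ℤˣ × Fin 7))) : Subgroup (MulAut E) :=
  (G.subgroupOf (Subgroup.normalizer (E : Set (Equiv.Perm (ℤˣ × Fin 7))))).map
    E.normalizerMonoidHom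

/-- The split version of `G`: the semidirect product of `E` by the group of automorphisms of `E`
that `G` induces by conjugation.  It is `4:S₄:2` for `G = 4.S₄:2`, and `2³:S₄` for `G = 2³.S₄`. -/
abbrev SplitVersion (G : Subgroup (Equiv.Perm (ℤˣ × Fin 7))) : Type :=
  E ⋊[(inducedAut G).subtype] (inducedAut G)

/-- `G` is an extension of `A` by `Q`: there is a normal subgroup isomorphic to `A` (the kernel of
an epimorphism onto `Q`) with quotient `Q`. -/
def IsExtension (G A Q : Type) [Group G] [Group A] [Group Q] : Prop :=
  ∃ f : G →* Q, Function.Surjective f ∧ Nonempty (f.ker ≃* A)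

/-- `G` is a split extension `A:Q`: in addition the normal subgroup has a complement. -/
def IsSplitExtension (G A Q : Type) [Group G] [Group A] [Group Q] : Prop :=
  ∃ f : G →* Q, Function.Surjective f ∧ Nonempty (f.ker ≃* A) ∧
    ∃ K : Subgroup G, f.ker.IsComplement' K

/-- `G` is a non-split extension `A.Q`: it is an extension of `A` by `Q`, but not a split one. -/
def IsNonsplitExtension (G A Q : Type) [Group G] [Group A] [Group Q] : Prop :=
  IsExtension G A Q ∧ ¬ IsSplitExtension G A Q

/-- The elementary abelian group `2ⁿ`. -/
abbrev ElemAb (n : ℕ) : Type := Multiplicative (Fin n → ZMod 2)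

/-- The symmetric group `S₄`. -/
abbrev S4 : Type := Equiv.Perm (Fin 4)

/-- `χ : G → ℂ` is the character of an irreducible finite-dimensional complex representation. -/
def IsIrreducibleCharacter {G : Type} [Group G] (χ : G → ℂ) : Prop :=
  ∃ (d : ℕ) (ρ : Representation ℂ G (Fin d → ℂ)), ρ.IsIrreducible ∧ ρ.character = χ

/-- `T` is the character table of `G`, with columns indexed by the conjugacy classes `C j`, where
the class `C j` has `size j` elements, of order `ord j`, and with rows indexed (without
repetition) by all the irreducible complex characters. -/
def HasCharacterTable (G : Type) [Group G] {n : ℕ} (size ord : Fin n → ℕ)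
    (T : Matrix (Fin n) (Fin n) ℤ) : Prop :=
  ∃ C : Fin n ≃ ConjClasses G,
    (∀ j, (C j).carrier.ncard = size j ∧ ∀ g ∈ (C j).carrier, orderOf g = ord j) ∧
    ∃ χ : Fin n → G → ℂ, Function.Injective χ ∧
      Set.range χ = {ψ | IsIrreducibleCharacter ψ} ∧
      ∀ i j, ∀ g ∈ (C j).carrier, χ i g = (T i j : ℂ)

/-- The common class sizes of `4.S₄:2` and `4:S₄:2`. -/
def sizeV : Fin 14 → ℕ := ![1, 3, 4, 12, 12, 12, 32, 12, 6, 6, 12, 32, 24, 24]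

/-- The orders of the elements in the classes of `4.S₄:2`. -/
def ordVNonsplit : Fin 14 → ℕ := ![1, 2, 2, 2, 2, 2, 3, 4, 4, 4, 4, 6, 8, 8]

/-- The orders of the elements in the classes of `4:S₄:2`. -/
def ordVSplit : Fin 14 → ℕ := ![1, 2, 2, 4, 4, 4, 3, 2, 2, 2, 2, 6, 4, 4]

/-- The common character table of `4.S₄:2` and `4:S₄:2`. -/
def tableV : Matrix (Fin 14) (Fin 14) ℤ :=
  !![1, 1, 1, 1, 1, 1, 1, 1, 1, 1, 1, 1, 1, 1;
     1, 1, -1, 1, -1, -1, 1, 1, 1, 1, -1, -1, 1, -1;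
     1, 1, -1, -1, 1, -1, 1, -1, 1, 1, 1, -1, -1, 1;
     1, 1, 1, -1, -1, 1, 1, -1, 1, 1, -1, 1, -1, -1;
     2, 2, -2, 0, 0, -2, -1, 0, 2, 2, 0, 1, 0, 0;
     2, 2, 2, 0, 0, 2, -1, 0, 2, 2, 0, -1, 0, 0;
     3, 3, 3, -1, -1, -1, 0, -1, -1, -1, -1, 0, 1, 1;
     3, 3, 3, 1, 1, -1, 0, 1, -1, -1, 1, 0, -1, -1;
     3, 3, -3, 1, -1, 1, 0, 1, -1, -1, -1, 0, -1, 1;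
     3, 3, -3, -1, 1, 1, 0, -1, -1, -1, 1, 0, 1, -1;
     6, -2, 0, 0, -2, 0, 0, 0, -2, 2, 2, 0, 0, 0;
     6, -2, 0, 0, 2, 0, 0, 0, -2, 2, -2, 0, 0, 0;
     6, -2, 0, -2, 0, 0, 0, 2, 2, -2, 0, 0, 0, 0;
     6, -2, 0, 2, 0, 0, 0, -2, 2, -2, 0, 0, 0, 0]

/-- The common class sizes of `2³.S₄` and `2³:S₄`. -/
def sizeVII : Fin 13 → ℕ := ![1, 1, 6, 12, 24, 32, 6, 6, 12, 12, 32, 24, 24]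

/-- The orders of the elements in the classes of `2³.S₄`. -/
def ordVIINonsplit : Fin 13 → ℕ := ![1, 2, 2, 2, 2, 3, 4, 4, 4, 4, 6, 8, 8]

/-- The orders of the elements in the classes of `2³:S₄`. -/
def ordVIISplit : Fin 13 → ℕ := ![1, 2, 2, 4, 4, 3, 2, 2, 2, 2, 6, 4, 4]

/-- The common character table of `2³.S₄` and `2³:S₄`. -/
def tableVII : Matrix (Fin 13) (Fin 13) ℤ :=
  !![1, 1, 1, 1, 1, 1, 1, 1, 1, 1, 1, 1, 1;
     1, 1, 1, 1, -1, 1, 1, 1, -1, -1, 1, -1, -1;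
     2, 2, 2, 2, 0, -1, 2, 2, 0, 0, -1, 0, 0;
     3, 3, -1, -1, -1, 0, -1, 3, 1, 1, 0, -1, 1;
     3, 3, -1, -1, 1, 0, -1, 3, -1, -1, 0, 1, -1;
     3, 3, 3, -1, 1, 0, -1, -1, 1, 1, 0, -1, -1;
     3, 3, -1, -1, -1, 0, 3, -1, 1, 1, 0, 1, -1;
     3, 3, -1, -1, 1, 0, 3, -1, -1, -1, 0, -1, 1;
     3, 3, 3, -1, -1, 0, -1, -1, -1, -1, 0, 1, 1;
     4, -4, 0, 0, 0, 1, 0, 0, -2, 2, -1, 0, 0;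
     4, -4, 0, 0, 0, 1, 0, 0, 2, -2, -1, 0, 0;
     6, 6, -2, 2, 0, 0, -2, -2, 0, 0, 0, 0, 0;
     8, -8, 0, 0, 0, -1, 0, 0, 0, 0, 1, 0, 0]

/-- `G` has the shape `A.S₄:2` (nonsplit) or `A:S₄:2` (split) with `A` a four-group that is normal
in `G`: there is a normal subgroup `H ≥ A` with a complement of order `2` in `G`, and `H` is an
extension of `A` with quotient `S₄`. -/
def HasShapeFourS4Two (G : Type) [Group G] (split : Prop) : Prop :=
  ∃ A H : Subgroup G, A.Normal ∧ H.Normal ∧ A ≤ H ∧ Nonempty (A ≃* ElemAb 2) ∧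
    (∃ f : H →* S4, Function.Surjective f ∧ f.ker = A.subgroupOf H) ∧
    ((∃ K : Subgroup H, (A.subgroupOf H).IsComplement' K) ↔ split) ∧
    ∃ K : Subgroup G, Nat.card K = 2 ∧ H.IsComplement' K

end OctonionExtensions

/-!
Signed permutations are determined by the images of the seven units `e_i`, which are recorded as the
base `14` digits of a number, the *code*.  The codes turn the orders of the groups, lower bounds
for the sizes of conjugacy classes and the orders of elements into arithmetic of natural numbers
that the kernel evaluates.

*Extensions.*  Each of the two groups `G` acts on four blocks of units, and the kernel of this
action is `E`; comparing orders, `G / E` is `S₄`.  The nontrivial elements of `E` change the signs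
on the complements of the lines of the Fano plane, and these sets separate the points, so a signed
permutation that centralizes `E` is diagonal, and `G / E` is also the group of automorphisms induced
on `E`.  Conjugation of the elements of `E` by a signed permutation depends only on the underlying
permutation of the indices; therefore the split version of `G` is isomorphic to a group of signed
permutations, generated by `E` and the permutations underlying the generators of `G`
(`IsMonomialExtension.exists_splitModel`).

*Splitting.*  Let `N` be an elementary abelian group of order at most `8` and `Γ` a split extension
of `N` by `S₄`.  Then `Γ` has no element of order `8` (`orderOf_ne_eight_of_isComplement'`).  An
element of `S₄` has order `3`, or its fourth power is `1`; in the first case the sixth power of an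
element above it is `1`.  If `k ∈ Γ` satisfies `k⁴ = 1`, then its action `α` on `N` satisfies
`1 + α + α² + α³ = (1 + α)³ = 0`, as `1 + α` is nilpotent on a space of dimension at most `3` over
the field with two elements; hence `(n k)⁴ = 1` for all `n ∈ N`.  But both groups `G` contain
elements of order `8`, which gives that they are non-split extensions and are not isomorphic to
their split versions.  In `4.S₄:2` such an element fixes `e₆`, so it lies in the kernel `H` of the
sign character on the axis of `e₆`, and `H` does not split over its normal four-group either.

*Character tables.*  Numbers of fixed points are characters, and they generate a ring of generalized
characters.  A generalized character of norm `1` and positive degree is irreducible.  The rows of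
the tables are written as polynomials in five such characters (`rowsV`, `rowsVII`): the traces on
the spans of orbits of units, the numbers of fixed axes and lines, and the trace on a monomial
representation induced from the stabilizer of a flag of the Fano plane.  Orthonormality of the rows
is a computation in the table, and irreducible characters other than the rows would be orthogonal to
all of them (`hasCharacterTable_of_genChar`).  That the chosen elements represent all the conjugacy
classes follows since their columns are distinct and the sizes add up to `192`.
-/

namespace OctonionExtensions
open Representation

/-! ### Complete reducibility on the level of characters -/

section CharacterTheory

variable {G : Type} [Group G]

theorem isIrreducible_of_equiv {V W : Type*} [AddCommGroup V] [Module ℂ V] [AddCommGroup W]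
    [Module ℂ W] {ρ : Representation ℂ G V} {σ : Representation ℂ G W} (e : ρ.Equiv σ)
    [ρ.IsIrreducible] : σ.IsIrreducible := by
  have h := (irreducible_iff_isSimpleModule_asModule ρ).1 inferInstance
  rw [irreducible_iff_isSimpleModule_asModule]
  let f := IntertwiningMap.equivLinearMapAsModule ρ σ e.toIntertwiningMap
  have hf : Function.Bijective f := e.toLinearEquiv.bijective
  exact IsSimpleModule.congr (LinearEquiv.ofBijective f hf).symm

theorem isIrreducibleCharacter_character {V : Type*} [AddCommGroup V] [Module ℂ V]
    [FiniteDimensional ℂ V] (ρ : Representation ℂ G V) [ρ.IsIrreducible] :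
    IsIrreducibleCharacter ρ.character := by
  let b := (Module.finBasis ℂ V).equivFun
  let σ : Representation ℂ G (Fin (Module.finrank ℂ V) → ℂ) :=
    { toFun := fun g => b.conj (ρ g)
      map_one' := by rw [map_one]; exact b.conj_id
      map_mul' := fun g h => by rw [map_mul]; exact b.conj_comp _ _ }
  let e : ρ.Equiv σ := Representation.Equiv.mk b fun g => by
    ext v; simp [σ, LinearEquiv.conj_apply]
  exact ⟨_, σ, isIrreducible_of_equiv e, (char_iso e).symm⟩

theorem character_eq_add_of_isCompl {V : Type*} [AddCommGroup V] [Module ℂ V]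
    [FiniteDimensional ℂ V] {ρ : Representation ℂ G V} {p q : Subrepresentation ρ}
    (h : IsCompl p.toSubmodule q.toSubmodule) :
    ρ.character = p.toRepresentation.character + q.toRepresentation.character := by
  ext g
  let N : Bool → Submodule ℂ V := fun i => bif i then p.toSubmodule else q.toSubmodule
  have hN : DirectSum.IsInternal N :=
    (DirectSum.isInternal_submodule_iff_isCompl N (i := true) (j := false) (by decide)
      (by ext i; cases i <;> simp)).2 h
  have hf : ∀ i, Set.MapsTo (ρ g) (N i) (N i) := by
    rintro (_ | _)
    · exact q.apply_mem_toSubmodule g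
    · exact p.apply_mem_toSubmodule g
  have := LinearMap.trace_eq_sum_trace_restrict hN hf
  rw [Fintype.sum_bool] at this
  exact this

variable [Finite G]

/-- Complete reducibility on the level of characters. -/
theorem character_mem_closure {V : Type} [AddCommGroup V] [Module ℂ V] [FiniteDimensional ℂ V]
    (ρ : Representation ℂ G V) :
    ρ.character ∈ AddSubmonoid.closure {ψ : G → ℂ | IsIrreducibleCharacter ψ} := by
  induction hn : Module.finrank ℂ V using Nat.strong_induction_on generalizing V with
  | _ n ih =>
  subst hn
  by_cases hV : Subsingleton V
  · have : ρ.character = 0 := by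
      ext g
      rw [character, Subsingleton.elim (ρ g) 0, map_zero]; rfl
    rw [this]; exact zero_mem _
  by_cases hρ : ρ.IsIrreducible
  · exact AddSubmonoid.subset_closure (isIrreducibleCharacter_character ρ)
  rw [not_subsingleton_iff_nontrivial] at hV
  have hnt : Nontrivial (Subrepresentation ρ) := by
    refine ⟨⊥, ⊤, fun h => ?_⟩
    have : (⊥ : Submodule ℂ V) = ⊤ := congrArg Subrepresentation.toSubmodule h
    exact bot_ne_top this
  obtain ⟨p, hp0, hp1⟩ : ∃ p : Subrepresentation ρ, p ≠ ⊥ ∧ p ≠ ⊤ := by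
    by_contra! hc
    exact hρ ⟨fun p => or_iff_not_imp_left.2 (hc p)⟩
  have hss : IsSemisimpleRepresentation ρ := by
    have : NeZero (Nat.card G : ℂ) := ⟨Nat.cast_ne_zero.2 Nat.card_pos.ne'⟩
    infer_instance
  obtain ⟨q, hq⟩ := exists_isCompl p
  have hpq : IsCompl p.toSubmodule q.toSubmodule := by
    constructor
    · rw [disjoint_iff]
      exact congrArg Subrepresentation.toSubmodule hq.inf_eq_bot
    · rw [codisjoint_iff]
      exact congrArg Subrepresentation.toSubmodule hq.sup_eq_top
  have hp0' : p.toSubmodule ≠ ⊥ := fun h => hp0 (Subrepresentation.toSubmodule_injective h)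
  have hp1' : p.toSubmodule ≠ ⊤ := fun h => hp1 (Subrepresentation.toSubmodule_injective h)
  have hq1' : q.toSubmodule ≠ ⊤ := by
    intro h
    rw [h] at hpq
    exact hp0' (by simpa using hpq.inf_eq_bot)
  rw [character_eq_add_of_isCompl hpq]
  exact add_mem (ih _ (Submodule.finrank_lt hp1') _ rfl)
    (ih _ (Submodule.finrank_lt hq1') _ rfl)

end CharacterTheory

/-! ### Orthogonality of irreducible characters -/

section CharInner

variable {G : Type} [Group G] [Fintype G]

/-- The bilinear form `(φ, ψ) ↦ |G|⁻¹ ∑ φ(g) ψ(g⁻¹)` on the functions on `G`. -/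
noncomputable def charInner : (G → ℂ) →ₗ[ℂ] (G → ℂ) →ₗ[ℂ] ℂ :=
  LinearMap.mk₂ ℂ (fun φ ψ => (Nat.card G : ℂ)⁻¹ * ∑ g, φ g * ψ g⁻¹)
    (fun φ φ' ψ => by simp only [Pi.add_apply, add_mul, Finset.sum_add_distrib, mul_add])
    (fun c φ ψ => by
      simp only [Pi.smul_apply, smul_eq_mul, mul_assoc, ← Finset.mul_sum]; ring)
    (fun φ ψ ψ' => by simp only [Pi.add_apply, mul_add, Finset.sum_add_distrib])
    (fun c φ ψ => by
      simp only [Pi.smul_apply, smul_eq_mul, Finset.mul_sum]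
      exact Finset.sum_congr rfl fun g _ => by ring)

theorem charInner_apply (φ ψ : G → ℂ) :
    charInner φ ψ = (Nat.card G : ℂ)⁻¹ * ∑ g, φ g * ψ g⁻¹ := rfl

open scoped Classical in
theorem charInner_irreducible {φ ψ : G → ℂ} (hφ : IsIrreducibleCharacter φ)
    (hψ : IsIrreducibleCharacter ψ) : charInner φ ψ = if φ = ψ then 1 else 0 := by
  obtain ⟨d, ρ, hρ, rfl⟩ := hφ
  obtain ⟨d', σ, hσ, rfl⟩ := hψ
  have : Invertible (Nat.card G : ℂ) := invertibleOfNonzero (Nat.cast_ne_zero.2 Nat.card_pos.ne')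
  rw [charInner_apply, char_orthonormal ρ σ]
  by_cases h : Nonempty (σ.Equiv ρ)
  · rw [if_pos h, if_pos (char_iso h.some).symm]
  · rw [if_neg h, if_neg]
    intro heq
    have h1 := char_orthonormal ρ σ
    have h2 := char_orthonormal ρ ρ
    rw [if_neg h] at h1
    rw [if_pos ⟨Representation.Equiv.refl ρ⟩] at h2
    rw [← heq, h2] at h1
    exact one_ne_zero h1

omit [Fintype G] in
theorem IsIrreducibleCharacter.conj {ψ : G → ℂ} (h : IsIrreducibleCharacter ψ) {g g' : G}
    (hg : IsConj g g') : ψ g = ψ g' := by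
  obtain ⟨d, ρ, -, rfl⟩ := h
  obtain ⟨c, rfl⟩ := isConj_iff.1 hg
  exact (char_conj ρ g c).symm

/-- A generalized character of norm `1` and of positive degree is an irreducible character. -/
theorem isIrreducibleCharacter_of_charInner_self_eq_one {ψ : G → ℂ} {d : ℤ}
    (hψ : ψ ∈ Submodule.span ℤ {χ : G → ℂ | IsIrreducibleCharacter χ})
    (hnorm : charInner ψ ψ = 1) (hd : ψ 1 = d) (hpos : 0 < d) : IsIrreducibleCharacter ψ := by
  classical
  obtain ⟨c, hc, rfl⟩ := Submodule.mem_span_set.1 hψ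
  have hsq : ∑ χ ∈ c.support, c χ ^ 2 = 1 := by
    have : ((∑ χ ∈ c.support, c χ ^ 2 : ℤ) : ℂ) = 1 := by
      rw [← hnorm, Finsupp.sum]
      simp only [← Int.cast_smul_eq_zsmul ℂ, map_sum, LinearMap.sum_apply, map_smul,
        LinearMap.smul_apply, smul_eq_mul, Int.cast_sum, Int.cast_pow]
      refine Finset.sum_congr rfl fun χ hχ => ?_
      rw [Finset.sum_eq_single χ]
      · rw [charInner_irreducible (hc hχ) (hc hχ), if_pos rfl]; ring
      · intro χ' hχ' hne
        rw [charInner_irreducible (hc hχ') (hc hχ), if_neg hne]; ring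
      · exact fun h => absurd hχ h
    exact_mod_cast this
  have hone : ∀ χ ∈ c.support, 1 ≤ c χ ^ 2 := fun χ hχ => by
    have h := Finsupp.mem_support_iff.1 hχ
    have : 0 < c χ ^ 2 := by positivity
    omega
  have hcard : c.support.card = 1 := by
    apply le_antisymm
    · have := Finset.card_nsmul_le_sum c.support (fun χ => c χ ^ 2) 1 hone
      rw [hsq] at this
      simpa using this
    · rw [Nat.one_le_iff_ne_zero]
      intro h
      rw [Finset.card_eq_zero.1 h] at hsq
      simp at hsq
  obtain ⟨χ, hχ⟩ := Finset.card_eq_one.1 hcard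
  have hmem : IsIrreducibleCharacter χ := hc (by simp [hχ])
  rw [hχ, Finset.sum_singleton, sq_eq_one_iff] at hsq
  rw [Finsupp.sum, hχ, Finset.sum_singleton] at hd ⊢
  rcases hsq with h | h
  · rwa [h, one_smul]
  · exfalso
    obtain ⟨m, ρ, -, rfl⟩ := hmem
    rw [h, neg_smul, one_smul, Pi.neg_apply, char_one] at hd
    have : -(Module.finrank ℂ (Fin m → ℂ) : ℤ) = d := by exact_mod_cast hd
    omega

end CharInner

/-! ### Integer-valued generalized characters -/

section GenChar

variable {G : Type} [Group G] [Finite G]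

theorem character_mem_span {V : Type} [AddCommGroup V] [Module ℂ V] [FiniteDimensional ℂ V]
    (ρ : Representation ℂ G V) :
    ρ.character ∈ Submodule.span ℤ {χ : G → ℂ | IsIrreducibleCharacter χ} := by
  have h : AddSubmonoid.closure {χ : G → ℂ | IsIrreducibleCharacter χ} ≤
      (Submodule.span ℤ {χ : G → ℂ | IsIrreducibleCharacter χ}).toAddSubmonoid :=
    AddSubmonoid.closure_le.2 Submodule.subset_span
  exact h (character_mem_closure ρ)

theorem mul_mem_span_irreducible {φ ψ : G → ℂ}
    (hφ : φ ∈ Submodule.span ℤ {χ : G → ℂ | IsIrreducibleCharacter χ})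
    (hψ : ψ ∈ Submodule.span ℤ {χ : G → ℂ | IsIrreducibleCharacter χ}) :
    φ * ψ ∈ Submodule.span ℤ {χ : G → ℂ | IsIrreducibleCharacter χ} := by
  have h := Submodule.mul_mem_mul hφ hψ
  rw [Submodule.span_mul_span] at h
  refine Submodule.span_le.2 ?_ h
  rintro _ ⟨_, ⟨d, ρ, -, rfl⟩, _, ⟨d', σ, -, rfl⟩, rfl⟩
  simp only
  rw [← char_tensor]
  exact character_mem_span _

variable (G) in
/-- The ring of the integer-valued generalized characters of `G` that take the same value on an
element and on its inverse. -/
noncomputable def genChar : Subring (G → ℤ) where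
  carrier := {ψ | (fun g => (ψ g : ℂ)) ∈
      Submodule.span ℤ {χ : G → ℂ | IsIrreducibleCharacter χ} ∧ ∀ g, ψ g⁻¹ = ψ g}
  mul_mem' := by
    rintro φ ψ ⟨h1, h2⟩ ⟨h3, h4⟩
    refine ⟨?_, fun g => by simp [h2, h4]⟩
    convert mul_mem_span_irreducible h1 h3 using 1
    ext g; simp
  one_mem' := by
    refine ⟨?_, fun g => rfl⟩
    convert character_mem_span (Representation.trivial ℂ G ℂ) using 1
    ext g
    simp [character]
  add_mem' := by
    rintro φ ψ ⟨h1, h2⟩ ⟨h3, h4⟩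
    refine ⟨?_, fun g => by simp [h2, h4]⟩
    convert add_mem h1 h3 using 1
    ext g; simp
  zero_mem' := ⟨by simpa using! zero_mem _, fun g => rfl⟩
  neg_mem' := by
    rintro φ ⟨h1, h2⟩
    refine ⟨?_, fun g => by simp [h2]⟩
    convert neg_mem h1 using 1
    ext g; simp

/-- The number of fixed points of an action on a finite set is a character. -/
theorem card_fixedPoints_mem_genChar {Y : Type} [Fintype Y] [DecidableEq Y]
    (f : G →* Equiv.Perm Y) :
    (fun g => (Fintype.card {y // f g y = y} : ℤ)) ∈ genChar G := by
  constructor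
  · let ρ : Representation ℂ G (Y → ℂ) :=
      { toFun := fun g => LinearMap.funLeft ℂ ℂ (f g⁻¹)
        map_one' := by ext; simp [LinearMap.funLeft]
        map_mul' := fun g h => by ext; simp [LinearMap.funLeft] }
    convert character_mem_span ρ using 1
    ext g
    rw [character, LinearMap.trace_eq_matrix_trace ℂ (Pi.basisFun ℂ Y), Matrix.trace]
    simp only [Matrix.diag_apply, LinearMap.toMatrix_apply, Pi.basisFun_apply, Pi.basisFun_repr]
    simp only [ρ, MonoidHom.coe_mk, OneHom.coe_mk, LinearMap.funLeft_apply, Pi.single_apply,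
      Finset.sum_boole, Fintype.card_subtype]
    simp only [map_inv, Equiv.Perm.inv_eq_iff_eq, eq_comm (a := f g _)]
    norm_cast
  · intro g
    simp only [map_inv, Equiv.Perm.inv_eq_iff_eq, eq_comm (b := f g _)]

end GenChar

/-! ### A criterion for character tables -/

section CharacterTable

variable {G : Type} [Group G] [Finite G] {n : ℕ}

/-- Pairwise non-conjugate elements whose conjugacy classes have at least `size j` elements
represent all the classes if these numbers add up to the order of the group. -/
theorem exists_equiv_conjClasses (r : Fin n → G) (size : Fin n → ℕ)
    (hinj : Function.Injective fun j => ConjClasses.mk (r j))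
    (hle : ∀ j, size j ≤ (ConjClasses.mk (r j)).carrier.ncard)
    (hpos : ∑ j, size j = Nat.card G) :
    ∃ C : Fin n ≃ ConjClasses G, (∀ j, C j = ConjClasses.mk (r j)) ∧
      ∀ j, (C j).carrier.ncard = size j := by
  classical
  have : Fintype (ConjClasses G) := Fintype.ofFinite _
  have htot : ∑ c : ConjClasses G, c.carrier.ncard = Nat.card G := by
    rw [← Group.sum_card_conj_classes_eq_card, finsum_eq_sum_of_fintype]
  have himg : ∑ c ∈ Finset.univ.image (fun j => ConjClasses.mk (r j)), c.carrier.ncard =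
      ∑ j, (ConjClasses.mk (r j)).carrier.ncard := Finset.sum_image fun _ _ _ _ h => hinj h
  have h1 : ∑ j, size j ≤ ∑ j, (ConjClasses.mk (r j)).carrier.ncard :=
    Finset.sum_le_sum fun j _ => hle j
  have h2 : ∑ c ∈ Finset.univ.image (fun j => ConjClasses.mk (r j)), c.carrier.ncard ≤
      ∑ c : ConjClasses G, c.carrier.ncard := Finset.sum_le_sum_of_subset (Finset.subset_univ _)
  have heq : ∑ j, size j = ∑ j, (ConjClasses.mk (r j)).carrier.ncard := by omega
  have hsize := (Finset.sum_eq_sum_iff_of_le fun j _ => hle j).1 heq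
  have hsurj : Function.Surjective fun j => ConjClasses.mk (r j) := by
    intro c
    by_contra hc
    have hc' : c ∉ Finset.univ.image (fun j => ConjClasses.mk (r j)) := by
      simpa using hc
    have h3 := Finset.sum_le_sum_of_subset (f := fun c : ConjClasses G => c.carrier.ncard)
      (Finset.subset_univ (insert c (Finset.univ.image (fun j => ConjClasses.mk (r j)))))
    rw [Finset.sum_insert hc'] at h3
    have hcpos : 0 < c.carrier.ncard := by
      obtain ⟨g, rfl⟩ := ConjClasses.exists_rep c
      exact (Set.ncard_pos (Set.toFinite _)).2 ⟨g, ConjClasses.mem_carrier_mk⟩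
    omega
  exact ⟨Equiv.ofBijective _ ⟨hinj, hsurj⟩, fun j => rfl,
    fun j => (hsize j (Finset.mem_univ j)).symm⟩

omit [Finite G] in
theorem sum_eq_sum_conjClasses [Fintype G] (C : Fin n ≃ ConjClasses G) (r : Fin n → G)
    (hC : ∀ j, C j = ConjClasses.mk (r j)) (F : G → ℂ)
    (hF : ∀ g g', IsConj g g' → F g = F g') :
    ∑ g, F g = ∑ j, ((C j).carrier.ncard : ℂ) * F (r j) := by
  classical
  rw [← Finset.sum_fiberwise_of_maps_to (t := Finset.univ) (g := fun g => C.symm (ConjClasses.mk g))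
    (fun _ _ => Finset.mem_univ _)]
  refine Finset.sum_congr rfl fun j _ => ?_
  have hmem : ∀ g, C.symm (ConjClasses.mk g) = j ↔ IsConj (r j) g := fun g => by
    rw [Equiv.symm_apply_eq, hC, ConjClasses.mk_eq_mk_iff_isConj, isConj_comm]
  rw [Finset.sum_congr rfl (g := fun _ => F (r j)), Finset.sum_const, nsmul_eq_mul]
  · congr 2
    rw [← Set.ncard_coe_finset]
    congr 1
    ext g
    rw [Finset.mem_coe, Finset.mem_filter, hmem, hC, ConjClasses.mem_carrier_iff_mk_eq,
      ConjClasses.mk_eq_mk_iff_isConj, isConj_comm]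
    simp
  · intro g hg
    exact (hF _ _ ((hmem g).1 (Finset.mem_filter.1 hg).2)).symm

theorem genChar_conj {ψ : G → ℤ} (hψ : ψ ∈ genChar G) {g g' : G} (h : IsConj g g') :
    ψ g = ψ g' := by
  have key : ∀ φ ∈ Submodule.span ℤ {χ : G → ℂ | IsIrreducibleCharacter χ}, φ g = φ g' := by
    intro φ hφ
    induction hφ using Submodule.span_induction with
    | mem χ hχ => exact IsIrreducibleCharacter.conj hχ h
    | zero => rfl
    | add _ _ _ _ h1 h2 => rw [Pi.add_apply, Pi.add_apply, h1, h2]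
    | smul c _ _ h1 => rw [Pi.smul_apply, Pi.smul_apply, h1]
  have := key _ hψ.1
  simpa using this

/-- Criterion for a matrix to be the character table: generalized characters that take the values
of the matrix at representatives of the classes, such that the rows of the matrix are orthonormal
and its columns are distinct, are all the irreducible characters. -/
theorem hasCharacterTable_of_genChar {size ord : Fin n → ℕ} {T : Matrix (Fin n) (Fin n) ℤ}
    (r : Fin n → G) (χ : Fin n → G → ℤ) (hχ : ∀ i, χ i ∈ genChar G)
    (hval : ∀ i j, χ i (r j) = T i j) (hcol : Function.Injective T.transpose)
    (hrow : ∀ i k, ∑ j, (size j : ℤ) * (T i j * T k j) = if i = k then (Nat.card G : ℤ) else 0)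
    (hone : ∀ i, 0 < χ i 1) (hsum : ∑ j, size j = Nat.card G)
    (hle : ∀ j, size j ≤ (ConjClasses.mk (r j)).carrier.ncard)
    (hord : ∀ j, orderOf (r j) = ord j) : HasCharacterTable G size ord T := by
  classical
  have : Fintype G := Fintype.ofFinite G
  have hinj : Function.Injective fun j => ConjClasses.mk (r j) := by
    intro j k hjk
    apply hcol
    ext i
    rw [Matrix.transpose_apply, Matrix.transpose_apply, ← hval, ← hval]
    exact genChar_conj (hχ i) (ConjClasses.mk_eq_mk_iff_isConj.1 hjk)
  obtain ⟨C, hC, hCsize⟩ := exists_equiv_conjClasses r size hinj hle hsum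
  have hcarrier : ∀ j, ∀ g ∈ (C j).carrier, IsConj (r j) g := fun j g hg => by
    rw [hC, ConjClasses.mem_carrier_iff_mk_eq, ConjClasses.mk_eq_mk_iff_isConj] at hg
    exact hg.symm
  have hG : (Nat.card G : ℂ) ≠ 0 := Nat.cast_ne_zero.2 Nat.card_pos.ne'
  have hinner : ∀ i k, charInner (fun g => (χ i g : ℂ)) (fun g => (χ k g : ℂ)) =
      if i = k then 1 else 0 := by
    intro i k
    have h1 : ∑ g, ((χ i g : ℂ) * (χ k g⁻¹ : ℂ)) =
        ∑ j, ((C j).carrier.ncard : ℂ) * ((χ i (r j) : ℂ) * (χ k (r j) : ℂ)) := by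
      simp only [(hχ k).2]
      exact sum_eq_sum_conjClasses C r hC _ fun g g' h => by
        rw [genChar_conj (hχ i) h, genChar_conj (hχ k) h]
    have h2 : ((∑ j, (size j : ℤ) * (T i j * T k j) : ℤ) : ℂ) =
        ((if i = k then (Nat.card G : ℤ) else 0 : ℤ) : ℂ) := by rw [hrow]
    rw [charInner_apply, h1]
    simp only [hCsize, hval]
    push_cast at h2
    rw [h2]
    split <;> simp
  have hirr : ∀ i, IsIrreducibleCharacter fun g => (χ i g : ℂ) := fun i =>
    isIrreducibleCharacter_of_charInner_self_eq_one (hχ i).1 (by rw [hinner, if_pos rfl]) rfl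
      (hone i)
  refine ⟨C, fun j => ⟨hCsize j, fun g hg => ?_⟩, fun i g => (χ i g : ℂ), ?_, ?_, ?_⟩
  · obtain ⟨c, rfl⟩ := isConj_iff.1 (hcarrier j g hg)
    rw [← hord j]
    exact orderOf_injective (MulAut.conj c).toMonoidHom (MulAut.conj c).injective (r j)
  · intro i k hik
    have h1 := hinner i k
    have h2 := hinner i i
    simp only at hik
    rw [← hik, h2] at h1
    by_contra hne
    simp [hne] at h1
  · refine Set.Subset.antisymm (Set.range_subset_iff.2 hirr) ?_
    intro ψ hψ
    by_contra hnot
    have hz : ∀ i, charInner (fun g => (χ i g : ℂ)) ψ = 0 := fun i => by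
      rw [charInner_irreducible (hirr i) hψ, if_neg]
      exact fun h => hnot ⟨i, h⟩
    have hψinv : ∀ g g', IsConj g g' → ψ g⁻¹ = ψ g'⁻¹ := fun g g' h => by
      obtain ⟨c, rfl⟩ := isConj_iff.1 h
      exact hψ.conj (isConj_iff.2 ⟨c, by group⟩)
    -- `ψ` is orthogonal to the rows of an invertible matrix
    let v : Fin n → ℂ := fun j => (size j : ℂ) * ψ (r j)⁻¹
    have hTv : (T.map (Int.cast : ℤ → ℂ)).mulVec v = 0 := by
      ext i
      have h := hz i
      rw [charInner_apply, sum_eq_sum_conjClasses C r hC _ fun g g' h => by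
        rw [genChar_conj (hχ i) h, hψinv g g' h], mul_eq_zero, or_iff_right (inv_ne_zero hG)] at h
      rw [Pi.zero_apply, ← h, Matrix.mulVec, dotProduct]
      refine Finset.sum_congr rfl fun j _ => ?_
      rw [hval, hCsize, Matrix.map_apply]
      ring
    have hdet : IsUnit (T.map (Int.cast : ℤ → ℂ)) := by
      refine IsUnit.of_mul_eq_one ((Nat.card G : ℂ)⁻¹ •
        Matrix.of fun j k => (size j : ℂ) * (T k j : ℂ)) ?_
      ext i k
      rw [Matrix.mul_smul, Matrix.smul_apply, Matrix.mul_apply, Matrix.one_apply]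
      have h : ((∑ j, (size j : ℤ) * (T i j * T k j) : ℤ) : ℂ) =
          ((if i = k then (Nat.card G : ℤ) else 0 : ℤ) : ℂ) := by rw [hrow]
      push_cast at h
      have h' : ∑ j, (T.map (Int.cast : ℤ → ℂ)) i j *
          (Matrix.of fun j k => (size j : ℂ) * (T k j : ℂ)) j k =
          ∑ j, (size j : ℂ) * ((T i j : ℂ) * (T k j : ℂ)) :=
        Finset.sum_congr rfl fun j _ => by rw [Matrix.map_apply, Matrix.of_apply]; ring
      rw [h', h]
      split <;> simp
    have hv : v = 0 := Matrix.mulVec_injective_of_isUnit hdet (by rw [hTv, Matrix.mulVec_zero])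
    have hψ0 : ψ = 0 := by
      ext g
      obtain ⟨j, hj⟩ := C.surjective (ConjClasses.mk g⁻¹)
      have hg : IsConj (r j) g⁻¹ := hcarrier j _ (by rw [hj]; exact ConjClasses.mem_carrier_mk)
      have hsz : (size j : ℂ) ≠ 0 := by
        rw [← hCsize, Nat.cast_ne_zero, ← Nat.pos_iff_ne_zero, Set.ncard_pos (Set.toFinite _)]
        exact ⟨g⁻¹, by rw [hj]; exact ConjClasses.mem_carrier_mk⟩
      have := (mul_eq_zero.1 (congrFun hv j)).resolve_left hsz
      rw [hψinv _ _ hg, inv_inv] at this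
      exact this
    have h1 := charInner_irreducible hψ hψ
    rw [if_pos rfl, hψ0, map_zero] at h1
    exact zero_ne_one h1
  · intro i j g hg
    rw [← hval, genChar_conj (hχ i) (hcarrier j g hg)]

end CharacterTable

end OctonionExtensions

namespace OctonionExtensions
open Equiv

/-! ### Signed permutations and their codes -/

section SignedPermutations

/-- The signed permutations of the units: the permutations that commute with `x ↦ -x`. -/
def oddPerms : Subgroup (Perm (ℤˣ × Fin 7)) where
  carrier := {g | ∀ x, g (-x.1, x.2) = (-(g x).1, (g x).2)}
  mul_mem' := by
    intro g h hg hh x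
    rw [Perm.mul_apply, hh, hg]; rfl
  one_mem' := fun x => rfl
  inv_mem' := by
    intro g hg x
    rw [Perm.inv_eq_iff_eq, hg]
    simp

theorem signedPerm_mem_oddPerms (σ : Perm (Fin 7)) (M : Finset (Fin 7)) :
    signedPerm σ M ∈ oddPerms := by
  intro x
  refine Prod.ext ?_ rfl
  exact neg_mul _ _

theorem apply_eq_of_mem_oddPerms {g : Perm (ℤˣ × Fin 7)} (hg : g ∈ oddPerms) (x : ℤˣ × Fin 7) :
    g x = (x.1 * (g (1, x.2)).1, (g (1, x.2)).2) := by
  obtain ⟨u, i⟩ := x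
  rcases Int.units_eq_one_or u with rfl | rfl
  · simp
  · rw [hg (1, i)]; simp

/-- The number in `{0, …, 13}` that encodes a unit: `e_i` is encoded by `i` and `-e_i` by
`i + 7`. -/
def unitCode (x : ℤˣ × Fin 7) : ℕ := x.2 + if x.1 = 1 then 0 else 7

theorem unitCode_injective : Function.Injective unitCode := by decide +kernel

theorem unitCode_lt (x : ℤˣ × Fin 7) : unitCode x < 14 := by
  revert x; decide +kernel

/-- The number with base `14` digits the codes of the images of `e_0, …, e_6`. -/
def code (g : Perm (ℤˣ × Fin 7)) : ℕ := ∑ i : Fin 7, 14 ^ (i : ℕ) * unitCode (g (1, i))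

/-- The code of the image of the unit with code `d` under the signed permutation with code `a`. -/
def applyCode (a d : ℕ) : ℕ := (a / 14 ^ (d % 7) + 7 * (d / 7)) % 14

/-- The code of a product of signed permutations. -/
def mulCode (a b : ℕ) : ℕ := ∑ i ∈ Finset.range 7, 14 ^ i * applyCode a (b / 14 ^ i % 14)

theorem code_div_mod (g : Perm (ℤˣ × Fin 7)) (i : Fin 7) :
    code g / 14 ^ (i : ℕ) % 14 = unitCode (g (1, i)) := by
  have key : ∀ a : Fin 7 → ℕ, (∀ k, a k < 14) →
      (∑ k : Fin 7, 14 ^ (k : ℕ) * a k) / 14 ^ (i : ℕ) % 14 = a i := by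
    intro a h
    have h0 := h 0
    have h1 := h 1
    have h2 := h 2
    have h3 := h 3
    have h4 := h 4
    have h5 := h 5
    have h6 := h 6
    have hi : i = 0 ∨ i = 1 ∨ i = 2 ∨ i = 3 ∨ i = 4 ∨ i = 5 ∨ i = 6 := by
      revert i; decide
    have e : ∑ k : Fin 7, 14 ^ (k : ℕ) * a k =
        a 0 + 14 * a 1 + 196 * a 2 + 2744 * a 3 + 38416 * a 4 + 537824 * a 5 + 7529536 * a 6 := by
      rw [Fin.sum_univ_seven]
      simp
    rw [e]
    rcases hi with rfl | rfl | rfl | rfl | rfl | rfl | rfl <;> simp <;> omega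
  exact key _ fun k => unitCode_lt _

theorem applyCode_unitCode {g : Perm (ℤˣ × Fin 7)} (hg : g ∈ oddPerms) (x : ℤˣ × Fin 7) :
    applyCode (code g) (unitCode x) = unitCode (g x) := by
  have h1 : unitCode x % 7 = x.2 := by revert x; decide +kernel
  have h2 : ∀ y : ℤˣ × Fin 7, (unitCode y + 7 * (unitCode x / 7)) % 14 =
      unitCode (x.1 * y.1, y.2) := by revert x; decide +kernel
  rw [applyCode, h1, apply_eq_of_mem_oddPerms hg x, ← h2, ← code_div_mod g x.2, Nat.mod_add_mod]

theorem code_mul {g h : Perm (ℤˣ × Fin 7)} (hg : g ∈ oddPerms) :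
    code (g * h) = mulCode (code g) (code h) := by
  rw [mulCode, Finset.sum_range, code]
  refine Finset.sum_congr rfl fun i _ => ?_
  rw [code_div_mod, applyCode_unitCode hg, Perm.mul_apply]

theorem code_injOn : Set.InjOn code (oddPerms : Set (Perm (ℤˣ × Fin 7))) := by
  intro g hg h hh hgh
  ext1 x
  rw [apply_eq_of_mem_oddPerms hg, apply_eq_of_mem_oddPerms hh]
  have : g (1, x.2) = h (1, x.2) := unitCode_injective (by
    rw [← code_div_mod, ← code_div_mod, hgh])
  rw [this]

/-- Membership in a list of codes. -/
def memCode (c : ℕ) (l : List ℕ) : Bool := l.any (Nat.beq c)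

@[simp]
theorem memCode_eq_true {c : ℕ} {l : List ℕ} : memCode c l = true ↔ c ∈ l := by
  simp [memCode]

/-- Breadth-first enumeration of an orbit: `n` rounds, in each of which the maps in `fs` are
applied to the elements of the frontier `q`, and the elements that were not `seen` before form the
new frontier. -/
def orbitList (fs : List (ℕ → ℕ)) : ℕ → List ℕ → List ℕ → List ℕ
  | 0, _, seen => seen
  | n + 1, q, seen =>
    let new := ((fs.flatMap fun f => q.map f).filter fun c => !memCode c seen).dedup
    orbitList fs n new (new ++ seen)

theorem forall_mem_orbitList {fs : List (ℕ → ℕ)} {P : ℕ → Prop}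
    (hP : ∀ f ∈ fs, ∀ c, P c → P (f c)) (n : ℕ) {q seen : List ℕ} (hq : ∀ c ∈ q, P c)
    (hseen : ∀ c ∈ seen, P c) : ∀ c ∈ orbitList fs n q seen, P c := by
  induction n generalizing q seen with
  | zero => exact hseen
  | succ n ih =>
    have hnew : ∀ c ∈ ((fs.flatMap fun f => q.map f).filter fun c => !memCode c seen).dedup,
        P c := by
      intro c hc
      simp only [List.mem_dedup, List.mem_filter, List.mem_flatMap, List.mem_map] at hc
      obtain ⟨⟨f, hf, c', hc', rfl⟩, -⟩ := hc
      exact hP f hf _ (hq _ hc')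
    refine ih hnew fun c hc => ?_
    rcases List.mem_append.1 hc with hc | hc
    exacts [hnew c hc, hseen c hc]

theorem subset_orbitList (fs : List (ℕ → ℕ)) (n : ℕ) (q seen : List ℕ) :
    seen ⊆ orbitList fs n q seen := by
  induction n generalizing q seen with
  | zero => exact List.Subset.refl _
  | succ n ih => exact fun c hc => ih _ _ (List.mem_append_right _ hc)

theorem nodup_orbitList (fs : List (ℕ → ℕ)) (n : ℕ) (q : List ℕ) {seen : List ℕ}
    (hseen : seen.Nodup) : (orbitList fs n q seen).Nodup := by
  induction n generalizing q seen with
  | zero => exact hseen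
  | succ n ih =>
    refine ih _ (List.Nodup.append (List.nodup_dedup _) hseen fun c hc hc' => ?_)
    simp only [List.mem_dedup, List.mem_filter, Bool.not_eq_true', ← Bool.not_eq_true,
      memCode_eq_true] at hc
    exact hc.2 hc'

/-- The codes of the elements of the group generated by the signed permutations in `S`.  The list is
complete if `16` rounds exhaust the group; this is what `IsClosedList` expresses. -/
def groupCodes (S : List (Perm (ℤˣ × Fin 7))) : List ℕ :=
  orbitList (S.map fun s => mulCode (code s)) 16 [code 1] [code 1]

/-- The codes of conjugates of `r` under the group generated by the signed permutations in `S`.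
That there are no others is not needed: lower bounds for the sizes of the classes suffice. -/
def conjCodes (S : List (Perm (ℤˣ × Fin 7))) (r : Perm (ℤˣ × Fin 7)) : List ℕ :=
  orbitList (S.map fun s c => mulCode (mulCode (code s) c) (code s⁻¹)) 16 [code r] [code r]

end SignedPermutations

/-! ### Enumeration of groups and conjugacy classes -/

section Enumeration

variable {Γ : Type} [Group Γ] {S : List (Perm (ℤˣ × Fin 7))}

theorem closure_le_oddPerms (hS : ∀ s ∈ S, s ∈ oddPerms) :
    Subgroup.closure {s | s ∈ S} ≤ oddPerms :=
  (Subgroup.closure_le _).2 hS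

theorem exists_code_eq_of_mem_groupCodes (hS : ∀ s ∈ S, s ∈ oddPerms) :
    ∀ c ∈ groupCodes S, ∃ g ∈ Subgroup.closure {s | s ∈ S}, code g = c := by
  have h1 : ∀ c ∈ [code 1], ∃ g ∈ Subgroup.closure {s | s ∈ S}, code g = c := by
    intro c hc
    exact ⟨1, one_mem _, (List.mem_singleton.1 hc).symm⟩
  refine forall_mem_orbitList ?_ 16 h1 h1
  simp only [List.mem_map]
  rintro _ ⟨s, hs, rfl⟩ _ ⟨g, hg, rfl⟩
  exact ⟨s * g, mul_mem (Subgroup.subset_closure hs) hg, code_mul (hS s hs)⟩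

theorem mem_closure_of_code_mem (hS : ∀ s ∈ S, s ∈ oddPerms) {g : Perm (ℤˣ × Fin 7)}
    (hg : g ∈ oddPerms) (hc : code g ∈ groupCodes S) : g ∈ Subgroup.closure {s | s ∈ S} := by
  obtain ⟨h, hh, hgh⟩ := exists_code_eq_of_mem_groupCodes hS _ hc
  rwa [← code_injOn (closure_le_oddPerms hS hh) hg hgh]

theorem nodup_groupCodes (S : List (Perm (ℤˣ × Fin 7))) : (groupCodes S).Nodup :=
  nodup_orbitList _ _ _ (List.nodup_singleton _)

theorem nodup_conjCodes (S : List (Perm (ℤˣ × Fin 7))) (r : Perm (ℤˣ × Fin 7)) :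
    (conjCodes S r).Nodup :=
  nodup_orbitList _ _ _ (List.nodup_singleton _)

/-- The list `groupCodes S` is closed under left multiplication by the generators. -/
def IsClosedList (S : List (Perm (ℤˣ × Fin 7))) : Prop :=
  (S.all fun s => (groupCodes S).all fun c => memCode (mulCode (code s) c) (groupCodes S)) = true

instance : Decidable (IsClosedList S) := inferInstanceAs (Decidable (_ = true))

theorem code_mem_groupCodes (hS : ∀ s ∈ S, s ∈ oddPerms) (hcl : IsClosedList S)
    {g : Perm (ℤˣ × Fin 7)} (hg : g ∈ Subgroup.closure {s | s ∈ S}) : code g ∈ groupCodes S := by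
  simp only [IsClosedList, List.all_eq_true, memCode_eq_true] at hcl
  rw [← Subgroup.mem_toSubmonoid, Subgroup.closure_toSubmonoid_of_finite] at hg
  induction hg using Submonoid.closure_induction_left with
  | one => exact subset_orbitList _ _ _ _ (List.mem_singleton.2 rfl)
  | mul_left s hs g _ ih => rw [code_mul (hS s hs)]; exact hcl s hs _ ih

theorem card_closure (hS : ∀ s ∈ S, s ∈ oddPerms) (hcl : IsClosedList S) :
    Nat.card (Subgroup.closure {s | s ∈ S}) = (groupCodes S).length := by
  have h : code '' (Subgroup.closure {s | s ∈ S} : Set (Perm (ℤˣ × Fin 7))) =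
      ((groupCodes S).toFinset : Set ℕ) := by
    ext c
    rw [List.coe_toFinset]
    constructor
    · rintro ⟨g, hg, rfl⟩
      exact code_mem_groupCodes hS hcl hg
    · exact exists_code_eq_of_mem_groupCodes hS c
  have h1 : (code '' (Subgroup.closure {s | s ∈ S} : Set (Perm (ℤˣ × Fin 7)))).ncard =
      (Subgroup.closure {s | s ∈ S} : Set (Perm (ℤˣ × Fin 7))).ncard :=
    (code_injOn.mono (closure_le_oddPerms hS)).ncard_image
  rw [h, Set.ncard_coe_finset, List.toFinset_card_of_nodup (nodup_groupCodes S)] at h1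
  rw [h1]; rfl

theorem length_conjCodes_le [Finite Γ] (φ : Γ →* Perm (ℤˣ × Fin 7))
    (hφ : φ.range = Subgroup.closure {s | s ∈ S}) (hS : ∀ s ∈ S, s ∈ oddPerms) (r : Γ) :
    (conjCodes S (φ r)).length ≤ (ConjClasses.mk r).carrier.ncard := by
  have hsub : ∀ c ∈ conjCodes S (φ r), ∃ x, IsConj r x ∧ code (φ x) = c := by
    have h1 : ∀ c ∈ [code (φ r)], ∃ x, IsConj r x ∧ code (φ x) = c := by
      intro c hc
      exact ⟨r, IsConj.refl r, (List.mem_singleton.1 hc).symm⟩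
    refine forall_mem_orbitList ?_ 16 h1 h1
    simp only [List.mem_map]
    rintro _ ⟨s, hs, rfl⟩ _ ⟨x, hx, rfl⟩
    obtain ⟨y, rfl⟩ : s ∈ φ.range := hφ ▸ Subgroup.subset_closure hs
    refine ⟨y * x * y⁻¹, hx.trans (isConj_iff.2 ⟨y, rfl⟩), ?_⟩
    have hx' : φ x ∈ oddPerms := closure_le_oddPerms hS (hφ ▸ ⟨x, rfl⟩)
    rw [map_mul, map_mul, map_inv, code_mul (mul_mem (hS _ hs) hx'), code_mul (hS _ hs)]
  have hle : ((conjCodes S (φ r)).toFinset : Set ℕ) ⊆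
      (fun x => code (φ x)) '' (ConjClasses.mk r).carrier := by
    intro c hc
    rw [List.coe_toFinset] at hc
    obtain ⟨x, hx, rfl⟩ := hsub c hc
    exact ⟨x, ConjClasses.mem_carrier_iff_mk_eq.2 (ConjClasses.mk_eq_mk_iff_isConj.2 hx.symm), rfl⟩
  have h1 := (Set.ncard_le_ncard hle (Set.toFinite _)).trans (Set.ncard_image_le (Set.toFinite _))
  rwa [Set.ncard_coe_finset, List.toFinset_card_of_nodup (nodup_conjCodes _ _)] at h1

theorem orderOf_eq_of_code {g : Perm (ℤˣ × Fin 7)} (hg : g ∈ oddPerms) {n : ℕ} (hn : 0 < n)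
    (h1 : (mulCode (code g))^[n] (code 1) = code 1)
    (h2 : ∀ m < n, 0 < m → (mulCode (code g))^[m] (code 1) ≠ code 1) : orderOf g = n := by
  have key : ∀ m, (mulCode (code g))^[m] (code 1) = code (g ^ m) := by
    intro m
    induction m with
    | zero => rfl
    | succ m ih => rw [Function.iterate_succ_apply', ih, ← code_mul hg, pow_succ']
  rw [orderOf_eq_iff hn]
  refine ⟨code_injOn (pow_mem hg n) (one_mem _) (by rw [← key, h1]), fun m hm hm' h => ?_⟩
  exact h2 m hm hm' (by rw [key, h])

end Enumeration

/-! ### Permutation characters on families of sets of units -/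

section FixedPoints

variable {Γ : Type} [Group Γ]

/-- The number of members of the family `𝓕` of sets of units that are mapped to themselves
by `g`. -/
def fixCount (𝓕 : Finset (Finset (ℤˣ × Fin 7))) (g : Perm (ℤˣ × Fin 7)) : ℤ :=
  (𝓕.filter fun s => s.image g = s).card

/-- The permutations that map the members of `𝓕` to members of `𝓕`. -/
def familyStabilizer (𝓕 : Finset (Finset (ℤˣ × Fin 7))) : Subgroup (Perm (ℤˣ × Fin 7)) where
  carrier := {g | 𝓕.image (Finset.image g) = 𝓕}
  mul_mem' := by
    intro g h hg hh
    have : Finset.image (⇑(g * h)) = Finset.image g ∘ Finset.image h := by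
      ext1 s; rw [Function.comp_apply, Finset.image_image]; rfl
    rw [Set.mem_ofPred_eq, this, ← Finset.image_image, hh, hg]
  one_mem' := by
    have : Finset.image (⇑(1 : Perm (ℤˣ × Fin 7))) = id := by ext1 s; exact Finset.image_id
    rw [Set.mem_ofPred_eq, this, Finset.image_id]
  inv_mem' := by
    intro g hg
    rw [Set.mem_ofPred_eq] at hg ⊢
    conv_lhs => rw [← hg]
    have : Finset.image (⇑g⁻¹) ∘ Finset.image g = id := by
      ext1 s; rw [Function.comp_apply, Finset.image_image, ← Perm.coe_mul, inv_mul_cancel]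
      exact Finset.image_id
    rw [Finset.image_image, this, Finset.image_id]

theorem image_mem_of_mem_familyStabilizer {𝓕 : Finset (Finset (ℤˣ × Fin 7))}
    {g : Perm (ℤˣ × Fin 7)} (hg : g ∈ familyStabilizer 𝓕) {s : Finset (ℤˣ × Fin 7)}
    (hs : s ∈ 𝓕) : s.image g ∈ 𝓕 := by
  have h : 𝓕.image (Finset.image g) = 𝓕 := hg
  rw [← h]
  exact Finset.mem_image_of_mem _ hs

/-- The action on an invariant family of sets of units. -/
def familyHom (φ : Γ →* Perm (ℤˣ × Fin 7)) (𝓕 : Finset (Finset (ℤˣ × Fin 7)))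
    (h : ∀ g, φ g ∈ familyStabilizer 𝓕) : Γ →* Perm {s // s ∈ 𝓕} :=
  MonoidHom.toHomPerm
    { toFun := fun g s => ⟨s.1.image (φ g), image_mem_of_mem_familyStabilizer (h g) s.2⟩
      map_one' := by
        funext s
        refine Subtype.ext ?_
        simp only [map_one]
        exact Finset.image_id
      map_mul' := fun g g' => by
        funext s
        refine Subtype.ext ?_
        change s.1.image (φ (g * g')) = (s.1.image (φ g')).image (φ g)
        rw [map_mul, Finset.image_image]
        rfl }

theorem fixCount_mem_genChar [Finite Γ] (φ : Γ →* Perm (ℤˣ × Fin 7))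
    {𝓕 : Finset (Finset (ℤˣ × Fin 7))} (h : ∀ g, φ g ∈ familyStabilizer 𝓕) :
    (fun g => fixCount 𝓕 (φ g)) ∈ genChar Γ := by
  convert card_fixedPoints_mem_genChar (familyHom φ 𝓕 h) using 3 with g
  rw [fixCount, ← Fintype.card_coe]
  congr 1
  exact Fintype.card_congr
    { toFun := fun s => ⟨⟨s.1, (Finset.mem_filter.1 s.2).1⟩,
        Subtype.ext (Finset.mem_filter.1 s.2).2⟩
      invFun := fun s => ⟨s.1.1, Finset.mem_filter.2 ⟨s.1.2, congrArg Subtype.val s.2⟩⟩ }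

end FixedPoints

/-! ### Character tables of groups of signed permutations -/

section CharacterTableCriterion

variable {Γ : Type} [Group Γ] [Finite Γ] {S : List (Perm (ℤˣ × Fin 7))}

theorem hasCharacterTable_of_codes {φ : Γ →* Perm (ℤˣ × Fin 7)} (hinj : Function.Injective φ)
    (hφ : φ.range = Subgroup.closure {s | s ∈ S}) (hS : ∀ s ∈ S, s ∈ oddPerms)
    {n : ℕ} {size ord : Fin n → ℕ} {T : Matrix (Fin n) (Fin n) ℤ} {rep : Fin n → Perm (ℤˣ × Fin 7)}
    (hrep : ∀ j, rep j ∈ Subgroup.closure {s | s ∈ S}) {χ : Fin n → Perm (ℤˣ × Fin 7) → ℤ}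
    (hχ : ∀ i, (fun g => χ i (φ g)) ∈ genChar Γ)
    (hval : ∀ i j, χ i (rep j) = T i j) (hcol : Function.Injective T.transpose)
    (hrow : ∀ i k, ∑ j, (size j : ℤ) * (T i j * T k j) = if i = k then (Nat.card Γ : ℤ) else 0)
    (hone : ∀ i, 0 < χ i 1) (hsum : ∑ j, size j = Nat.card Γ)
    (hsize : ∀ j, (conjCodes S (rep j)).length = size j)
    (hord : ∀ j, orderOf (rep j) = ord j) : HasCharacterTable Γ size ord T := by
  have hr : ∀ j, ∃ r, φ r = rep j := fun j => by
    rw [← MonoidHom.mem_range, hφ]; exact hrep j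
  choose r hr using hr
  refine hasCharacterTable_of_genChar r (fun i g => χ i (φ g)) hχ (fun i j => ?_) hcol hrow
    (fun i => ?_) hsum (fun j => ?_) fun j => ?_
  · rw [hr, hval]
  · rw [map_one]; exact hone i
  · rw [← hsize, ← hr]; exact length_conjCodes_le φ hφ hS (r j)
  · rw [← hord, ← hr, orderOf_injective φ hinj]

end CharacterTableCriterion

/-! ### Families of sets of units -/

section Families

/-- The pairs `{e_i, -e_i}` with `i ∈ O`. -/
def axes (O : Finset (Fin 7)) : Finset (Finset (ℤˣ × Fin 7)) :=
  O.image fun i => Finset.univ ×ˢ {i}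

/-- The singletons `{e_i}` and `{-e_i}` with `i ∈ O`. -/
def units (O : Finset (Fin 7)) : Finset (Finset (ℤˣ × Fin 7)) :=
  (Finset.univ ×ˢ O).image fun x => {x}

/-- The sets `{± e_i | i ∈ l}` for the sets `l` of indices in `L`. -/
def blocks (L : Finset (Finset (Fin 7))) : Finset (Finset (ℤˣ × Fin 7)) :=
  L.image fun l => Finset.univ ×ˢ l

/-- The flags `i ∈ l` with `i ∈ O` and `l ∈ L`, encoded by the sets `{± e_k | k ∈ l, k ≠ i}`. -/
def axisFlags (O : Finset (Fin 7)) (L : Finset (Finset (Fin 7))) :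
    Finset (Finset (ℤˣ × Fin 7)) :=
  ((O ×ˢ L).filter fun p => p.1 ∈ p.2).image fun p => Finset.univ ×ˢ p.2.erase p.1

/-- The flags `i ∈ l` with `i ∈ O` and `l ∈ L`, together with a choice of one of the units
`± e_i`, encoded by the sets that contain this unit and the `± e_k` with `k ∈ l`, `k ≠ i`. -/
def unitFlags (O : Finset (Fin 7)) (L : Finset (Finset (Fin 7))) :
    Finset (Finset (ℤˣ × Fin 7)) :=
  (Finset.univ ×ˢ (O ×ˢ L).filter fun p => p.1 ∈ p.2).image fun x =>
    insert (x.1, x.2.1) (Finset.univ ×ˢ x.2.2.erase x.2.1)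

end Families

/-! ### The rows of the first table -/

section FirstTable

/-- The indices of the units other than `± e₆`. -/
def hexad : Finset (Fin 7) := {1, 2, 3, 4, 5, 7}

/-- The lines of the Fano plane that do not pass through the point `6`. -/
def hexadLines : Finset (Finset (Fin 7)) := {{1, 2, 3}, {1, 4, 7}, {2, 5, 7}, {3, 4, 5}}

/-- The values of five generalized characters from which the rows of `tableV` are obtained:
the traces on the span of `e₆` and on that of the other units, the numbers of fixed axes and of
fixed lines, and the trace of the monomial representation on the flags. -/
def invariantsV (g : Perm (ℤˣ × Fin 7)) : Fin 5 → ℤ :=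
  ![fixCount (units {6}) g - fixCount (axes {6}) g,
    fixCount (units hexad) g - fixCount (axes hexad) g,
    fixCount (axes hexad) g,
    fixCount (blocks hexadLines) g,
    fixCount (unitFlags hexad hexadLines) g - fixCount (axisFlags hexad hexadLines) g]

/-- The rows of `tableV` as polynomials in the generalized characters of `invariantsV`.  Here `1`,
`s`, `D`, `P`, `Q` are the irreducible characters of the quotient `S₄`. -/
def rowsV {R : Type*} [CommRing R] (x : Fin 5 → R) : Fin 14 → R :=
  let e := x 0
  let t := x 1
  let P := x 3 - 1
  let D := x 2 - 1 - P
  let Q := P * P - 1 - D - P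
  let s := P * Q - D - P - Q
  let u := x 4 - t
  ![1, e * s, e, s, e * D, D, Q, P, e * Q, e * P, t, s * t, u, s * u]

theorem rowsV_mem {R : Type*} [CommRing R] (A : Subring R) {x : Fin 5 → R} (hx : ∀ k, x k ∈ A)
    (i : Fin 14) : rowsV x i ∈ A := by
  have h := fun i => (rowsV (fun k => (⟨x k, hx k⟩ : A)) i).2
  convert h i using 1
  fin_cases i <;> rfl

theorem rowsV_apply {α : Type*} (x : Fin 5 → α → ℤ) (i : Fin 14) (a : α) :
    rowsV x i a = rowsV (fun k => x k a) i := by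
  fin_cases i <;> rfl

/-- The values of `invariantsV` on the classes of `4.S₄:2` and `4:S₄:2`. -/
def valuesV : Fin 14 → Fin 5 → ℤ :=
  ![![1, 6, 6, 4, 12], ![1, -2, 6, 4, -4], ![-1, 0, 6, 4, 0], ![-1, 0, 2, 2, -2],
    ![1, -2, 2, 2, -2], ![-1, 0, 2, 0, 0], ![1, 0, 0, 1, 0], ![-1, 0, 2, 2, 2],
    ![1, -2, 2, 0, 0], ![1, 2, 2, 0, 0], ![1, 2, 2, 2, 2], ![-1, 0, 0, 1, 0],
    ![-1, 0, 0, 0, 0], ![1, 0, 0, 0, 0]]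

theorem rowsV_valuesV : ∀ (j i : Fin 14), (rowsV (valuesV j) i : ℤ) = tableV i j := by
  decide +kernel

theorem tableV_orthogonal :
    ∀ i k, ∑ j, (sizeV j : ℤ) * (tableV i j * tableV k j) = if i = k then 192 else 0 := by
  decide +kernel

theorem tableV_columns : ∀ j k, (∀ i, tableV i j = tableV i k) → j = k := by decide +kernel

/-- The families of sets of units that enter into `invariantsV`. -/
def familiesV : List (Finset (Finset (ℤˣ × Fin 7))) :=
  [units {6}, axes {6}, units hexad, axes hexad, blocks hexadLines, unitFlags hexad hexadLines,
    axisFlags hexad hexadLines]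

theorem invariantsV_mem_genChar {Γ : Type} [Group Γ] [Finite Γ] (φ : Γ →* Perm (ℤˣ × Fin 7))
    (h : ∀ 𝓕 ∈ familiesV, ∀ g, φ g ∈ familyStabilizer 𝓕) (k : Fin 5) :
    (fun g => invariantsV (φ g) k) ∈ genChar Γ := by
  have h' := fun 𝓕 h𝓕 => fixCount_mem_genChar φ (h 𝓕 h𝓕)
  fin_cases k
  · exact sub_mem (h' _ (by simp [familiesV])) (h' _ (by simp [familiesV]))
  · exact sub_mem (h' _ (by simp [familiesV])) (h' _ (by simp [familiesV]))
  · exact h' _ (by simp [familiesV])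
  · exact h' _ (by simp [familiesV])
  · exact sub_mem (h' _ (by simp [familiesV])) (h' _ (by simp [familiesV]))

theorem hasCharacterTable_tableV {Γ : Type} [Group Γ] {S : List (Perm (ℤˣ × Fin 7))}
    {φ : Γ →* Perm (ℤˣ × Fin 7)} (hinj : Function.Injective φ)
    (hφ : φ.range = Subgroup.closure {s | s ∈ S}) (hS : ∀ s ∈ S, s ∈ oddPerms)
    (hcard : Nat.card Γ = 192) (hfam : ∀ 𝓕 ∈ familiesV, ∀ s ∈ S, s ∈ familyStabilizer 𝓕)
    {ord : Fin 14 → ℕ} {rep : Fin 14 → Perm (ℤˣ × Fin 7)}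
    (hrep : ∀ j, rep j ∈ Subgroup.closure {s | s ∈ S})
    (hval : ∀ j, invariantsV (rep j) = valuesV j)
    (hsize : ∀ j, (conjCodes S (rep j)).length = sizeV j)
    (hord : ∀ j, orderOf (rep j) = ord j) : HasCharacterTable Γ sizeV ord tableV := by
  have : Finite Γ := Nat.finite_of_card_ne_zero (by omega)
  have hfam' : ∀ 𝓕 ∈ familiesV, ∀ g, φ g ∈ familyStabilizer 𝓕 := fun 𝓕 h𝓕 g =>
    (Subgroup.closure_le _).2 (hfam 𝓕 h𝓕) (hφ ▸ ⟨g, rfl⟩)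
  have hone : ∀ i, 0 < rowsV (invariantsV 1) i := by
    have h1 : invariantsV 1 = valuesV 0 := by decide +kernel
    rw [h1]
    decide +kernel
  refine hasCharacterTable_of_codes (χ := fun i g => rowsV (invariantsV g) i) hinj hφ hS hrep
    (fun i => ?_) (fun i j => ?_) (fun j k hjk => ?_) (fun i k => ?_) hone ?_ hsize hord
  · have h := rowsV_mem (genChar Γ) (invariantsV_mem_genChar φ hfam') i
    convert h using 1
    ext g
    rw [rowsV_apply]
  · simp only [hval, rowsV_valuesV]
  · exact tableV_columns j k fun i => congrFun hjk i
  · rw [hcard]; exact tableV_orthogonal i k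
  · rw [hcard]; decide

end FirstTable

/-! ### The rows of the second table -/

section SecondTable

/-- The line of the Fano plane that is invariant under `2³.S₄`. -/
def triad : Finset (Fin 7) := {2, 4, 6}

/-- The complement of the invariant line. -/
def tetrad : Finset (Fin 7) := {1, 3, 5, 7}

/-- The lines of the Fano plane other than the invariant line. -/
def triadLines : Finset (Finset (Fin 7)) :=
  {{1, 2, 3}, {1, 4, 7}, {1, 5, 6}, {2, 5, 7}, {3, 4, 5}, {3, 6, 7}}

/-- The values of five generalized characters from which the rows of `tableVII` are obtained:
the traces on the spans of the units with indices in the two orbits, the numbers of fixed axes in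
the two orbits, and the trace of the monomial representation on the flags. -/
def invariantsVII (g : Perm (ℤˣ × Fin 7)) : Fin 5 → ℤ :=
  ![fixCount (units triad) g - fixCount (axes triad) g,
    fixCount (units tetrad) g - fixCount (axes tetrad) g,
    fixCount (axes triad) g,
    fixCount (axes tetrad) g,
    fixCount (unitFlags triad triadLines) g - fixCount (axisFlags triad triadLines) g]

/-- The rows of `tableVII` as polynomials in the generalized characters of `invariantsVII`.  Here
`1`, `s`, `D`, `P`, `Q` are the irreducible characters of the quotient `S₄`. -/
def rowsVII {R : Type*} [CommRing R] (x : Fin 5 → R) : Fin 13 → R :=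
  let a := x 0
  let b := x 1
  let P := x 3 - 1
  let D := x 2 - 1
  let Q := P * P - 1 - D - P
  let s := P * Q - D - P - Q
  let w := x 4 - a
  ![1, s, D, w, w * s, P, a, a * s, Q, b * s, b, a * P - w, b * D]

theorem rowsVII_mem {R : Type*} [CommRing R] (A : Subring R) {x : Fin 5 → R} (hx : ∀ k, x k ∈ A)
    (i : Fin 13) : rowsVII x i ∈ A := by
  have h := fun i => (rowsVII (fun k => (⟨x k, hx k⟩ : A)) i).2
  convert h i using 1
  fin_cases i <;> rfl

theorem rowsVII_apply {α : Type*} (x : Fin 5 → α → ℤ) (i : Fin 13) (a : α) :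
    rowsVII x i a = rowsVII (fun k => x k a) i := by
  fin_cases i <;> rfl

/-- The values of `invariantsVII` on the classes of `2³.S₄` and `2³:S₄`. -/
def valuesVII : Fin 13 → Fin 5 → ℤ :=
  ![![3, 4, 3, 4, 6], ![3, -4, 3, 4, 6], ![-1, 0, 3, 4, -2], ![-1, 0, 3, 0, -2],
    ![-1, 0, 1, 2, -2], ![0, 1, 0, 1, 0], ![3, 0, 3, 0, 2], ![-1, 0, 3, 0, 2],
    ![1, 2, 1, 2, 2], ![1, -2, 1, 2, 2], ![0, -1, 0, 1, 0], ![1, 0, 1, 0, 0], ![-1, 0, 1, 0, 0]]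

theorem rowsVII_valuesVII : ∀ (j i : Fin 13), (rowsVII (valuesVII j) i : ℤ) = tableVII i j := by
  decide +kernel

theorem tableVII_orthogonal :
    ∀ i k, ∑ j, (sizeVII j : ℤ) * (tableVII i j * tableVII k j) = if i = k then 192 else 0 := by
  decide +kernel

theorem tableVII_columns : ∀ j k, (∀ i, tableVII i j = tableVII i k) → j = k := by decide +kernel

/-- The families of sets of units that enter into `invariantsVII`. -/
def familiesVII : List (Finset (Finset (ℤˣ × Fin 7))) :=
  [units triad, axes triad, units tetrad, axes tetrad, unitFlags triad triadLines,
    axisFlags triad triadLines]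

theorem invariantsVII_mem_genChar {Γ : Type} [Group Γ] [Finite Γ] (φ : Γ →* Perm (ℤˣ × Fin 7))
    (h : ∀ 𝓕 ∈ familiesVII, ∀ g, φ g ∈ familyStabilizer 𝓕) (k : Fin 5) :
    (fun g => invariantsVII (φ g) k) ∈ genChar Γ := by
  have h' := fun 𝓕 h𝓕 => fixCount_mem_genChar φ (h 𝓕 h𝓕)
  fin_cases k
  · exact sub_mem (h' _ (by simp [familiesVII])) (h' _ (by simp [familiesVII]))
  · exact sub_mem (h' _ (by simp [familiesVII])) (h' _ (by simp [familiesVII]))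
  · exact h' _ (by simp [familiesVII])
  · exact h' _ (by simp [familiesVII])
  · exact sub_mem (h' _ (by simp [familiesVII])) (h' _ (by simp [familiesVII]))

theorem hasCharacterTable_tableVII {Γ : Type} [Group Γ] {S : List (Perm (ℤˣ × Fin 7))}
    {φ : Γ →* Perm (ℤˣ × Fin 7)} (hinj : Function.Injective φ)
    (hφ : φ.range = Subgroup.closure {s | s ∈ S}) (hS : ∀ s ∈ S, s ∈ oddPerms)
    (hcard : Nat.card Γ = 192) (hfam : ∀ 𝓕 ∈ familiesVII, ∀ s ∈ S, s ∈ familyStabilizer 𝓕)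
    {ord : Fin 13 → ℕ} {rep : Fin 13 → Perm (ℤˣ × Fin 7)}
    (hrep : ∀ j, rep j ∈ Subgroup.closure {s | s ∈ S})
    (hval : ∀ j, invariantsVII (rep j) = valuesVII j)
    (hsize : ∀ j, (conjCodes S (rep j)).length = sizeVII j)
    (hord : ∀ j, orderOf (rep j) = ord j) : HasCharacterTable Γ sizeVII ord tableVII := by
  have : Finite Γ := Nat.finite_of_card_ne_zero (by omega)
  have hfam' : ∀ 𝓕 ∈ familiesVII, ∀ g, φ g ∈ familyStabilizer 𝓕 := fun 𝓕 h𝓕 g =>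
    (Subgroup.closure_le _).2 (hfam 𝓕 h𝓕) (hφ ▸ ⟨g, rfl⟩)
  have hone : ∀ i, 0 < rowsVII (invariantsVII 1) i := by
    have h1 : invariantsVII 1 = valuesVII 0 := by decide +kernel
    rw [h1]
    decide +kernel
  refine hasCharacterTable_of_codes (χ := fun i g => rowsVII (invariantsVII g) i) hinj hφ hS hrep
    (fun i => ?_) (fun i j => ?_) (fun j k hjk => ?_) (fun i k => ?_) hone ?_ hsize hord
  · have h := rowsVII_mem (genChar Γ) (invariantsVII_mem_genChar φ hfam') i
    convert h using 1
    ext g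
    rw [rowsVII_apply]
  · simp only [hval, rowsVII_valuesVII]
  · exact tableVII_columns j k fun i => congrFun hjk i
  · rw [hcard]; exact tableVII_orthogonal i k
  · rw [hcard]; decide

end SecondTable

/-! ### Extensions of elementary abelian groups by the symmetric group -/

section Extensions

theorem nonempty_mulEquiv_elemAb {K : Type} [Group K] {n : ℕ} (hcard : Nat.card K = 2 ^ n)
    (hsq : ∀ x : K, x * x = 1) : Nonempty (K ≃* ElemAb n) := by
  have hinv : ∀ x : K, x⁻¹ = x := fun x => inv_eq_of_mul_eq_one_left (hsq x)
  let _ : CommGroup K :=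
    { mul_comm := fun x y => by rw [← hinv (x * y), mul_inv_rev, hinv, hinv] }
  let _ : Module (ZMod 2) (Additive K) := AddCommGroup.zmodModule fun x => by
    rw [two_nsmul]; exact hsq x
  have : Finite K := Nat.finite_of_card_ne_zero (by rw [hcard]; positivity)
  have : Finite (Additive K) := this
  have hrank : Module.finrank (ZMod 2) (Additive K) = n := by
    have h := Module.natCard_eq_pow_finrank (K := ZMod 2) (V := Additive K)
    rw [Nat.card_zmod] at h
    have h' : Nat.card (Additive K) = 2 ^ n := hcard
    rw [h'] at h
    exact (Nat.pow_right_injective (le_refl 2) h).symm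
  let e : Additive K ≃ₗ[ZMod 2] (Fin n → ZMod 2) :=
    (Module.finBasisOfFinrankEq (ZMod 2) (Additive K) hrank).equivFun
  exact ⟨AddEquiv.toMultiplicativeRight e.toAddEquiv⟩

/-- An automorphism `α` with `α ^ 4 = 1` of an elementary abelian `2`-group of rank at most `3`
satisfies `1 + α + α² + α³ = 0`: the sum is `(1 + α)³`, and `1 + α` is nilpotent. -/
theorem mul_apply_pow_eq_one {A : Type} [Group A] {m : ℕ} (hm : m ≤ 3) (i : A ≃* ElemAb m)
    (α : MulAut A) (hα : α ^ 4 = 1) (a : A) : a * α a * (α ^ 2) a * (α ^ 3) a = 1 := by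
  let T : Module.End (ZMod 2) (Fin m → ZMod 2) := AddMonoidHom.toZModLinearMap 2
    (AddMonoidHom.toMultiplicative.symm
      ((i.toMonoidHom.comp α.toMonoidHom).comp i.symm.toMonoidHom))
  have hT : ∀ (k : ℕ) (x : A), (T ^ k) (Multiplicative.toAdd (i x)) =
      Multiplicative.toAdd (i ((α ^ k) x)) := by
    intro k
    induction k with
    | zero => intro x; rfl
    | succ k ih =>
      intro x
      have h1 : T (Multiplicative.toAdd (i x)) = Multiplicative.toAdd (i (α x)) := by
        change Multiplicative.toAdd (i (α (i.symm (i x)))) = _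
        rw [i.symm_apply_apply]
      rw [pow_succ, Module.End.mul_apply, h1, ih, pow_succ]
      rfl
  have hT4 : T ^ 4 = 1 := by
    refine LinearMap.ext fun v => ?_
    obtain ⟨x, rfl⟩ : ∃ x, v = Multiplicative.toAdd (i x) :=
      ⟨i.symm (Multiplicative.ofAdd v), by rw [i.apply_symm_apply]; rfl⟩
    rw [hT, hα]; rfl
  have h2 : (2 : Module.End (ZMod 2) (Fin m → ZMod 2)) = 0 := by
    refine one_add_one_eq_two.symm.trans (LinearMap.ext fun v => funext fun j => ?_)
    exact CharTwo.add_self_eq_zero _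
  have hN4 : (1 + T) ^ 4 = 0 := by
    have : (1 + T) ^ 4 = 1 + T ^ 4 + 2 * (2 * T + 3 * T ^ 2 + 2 * T ^ 3) := by noncomm_ring
    rw [this, hT4, h2, zero_mul, add_zero, one_add_one_eq_two, h2]
  have hN3 : (1 + T) ^ 3 = 0 := by
    have hker := Module.End.ker_pow_le_ker_pow_finrank (1 + T) 4
    rw [hN4, LinearMap.ker_zero, top_le_iff, LinearMap.ker_eq_top, Module.finrank_fin_fun] at hker
    exact pow_eq_zero_of_le hm hker
  have hsum : 1 + T + T ^ 2 + T ^ 3 = 0 := by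
    have : (1 + T) ^ 3 = 1 + T + T ^ 2 + T ^ 3 + 2 * (T + T ^ 2) := by noncomm_ring
    rw [← hN3, this, h2, zero_mul, add_zero]
  apply i.injective
  rw [map_mul, map_mul, map_mul, map_one]
  apply Multiplicative.toAdd.injective
  have h := LinearMap.congr_fun hsum (Multiplicative.toAdd (i a))
  have h1 := hT 1 a
  rw [pow_one, pow_one] at h1
  rw [LinearMap.add_apply, LinearMap.add_apply, LinearMap.add_apply, hT, hT, h1] at h
  exact h

/-- A split extension of an elementary abelian group of order at most `8` by `S₄` has no elements
of order `8`. -/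
theorem orderOf_ne_eight_of_isComplement' {Γ : Type} [Group Γ] (f : Γ →* S4) {m : ℕ}
    (hm : m ≤ 3) (i : f.ker ≃* ElemAb m) {K : Subgroup Γ} (hK : f.ker.IsComplement' K) (g : Γ) :
    orderOf g ≠ 8 := by
  have hsq : ∀ x ∈ f.ker, x * x = 1 := by
    intro x hx
    have h : (⟨x, hx⟩ : f.ker) * ⟨x, hx⟩ = 1 := by
      apply i.injective
      rw [map_mul, map_one]
      apply Multiplicative.toAdd.injective
      ext j
      exact CharTwo.add_self_eq_zero _
    exact congrArg Subtype.val h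
  have hS4 : ∀ p : S4, p ^ 4 = 1 ∨ p ^ 3 = 1 := by decide +kernel
  intro hg
  rcases hS4 (f g) with h | h
  · obtain ⟨⟨⟨n, hn⟩, ⟨k, hk⟩⟩, hnk, -⟩ := hK.existsUnique g
    have hnk : n * k = g := hnk
    have hfk : f g = f k := by rw [← hnk, map_mul, f.mem_ker.1 hn, one_mul]
    have hk4 : k ^ 4 = 1 := by
      have h1 : k ^ 4 ∈ f.ker := by rw [f.mem_ker, map_pow, ← hfk, h]
      exact Subgroup.disjoint_def.1 hK.disjoint h1 (pow_mem hk 4)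
    -- `(n k)⁴` is the product of the conjugates of `n` by `1, k, k², k³`
    have hα : (MulAut.conjNormal k : MulAut f.ker) ^ 4 = 1 := by
      rw [← map_pow, hk4, map_one]
    have h2 := congrArg Subtype.val
      (mul_apply_pow_eq_one hm i (MulAut.conjNormal k) hα ⟨n, hn⟩)
    rw [← map_pow, ← map_pow] at h2
    simp only [Subgroup.coe_mul, MulAut.conjNormal_apply, Subgroup.coe_one] at h2
    have h3 : g ^ 4 = 1 := by
      calc g ^ 4
          = n * (k * n * k⁻¹) * (k ^ 2 * n * (k ^ 2)⁻¹) * (k ^ 3 * n * (k ^ 3)⁻¹) * k ^ 4 := by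
            rw [← hnk]; simp only [pow_succ, pow_zero, one_mul]; group
        _ = 1 := by rw [h2, hk4, one_mul]
    have h4 := orderOf_dvd_of_pow_eq_one h3
    rw [hg] at h4
    omega
  · have h1 : g ^ 3 * g ^ 3 = 1 := hsq _ (by rw [f.mem_ker, map_pow, h])
    rw [← pow_add] at h1
    have h4 := orderOf_dvd_of_pow_eq_one h1
    rw [hg] at h4
    omega

variable {Γ : Type} [Group Γ]

theorem IsSplitExtension.orderOf_ne_eight (h : IsSplitExtension Γ (ElemAb 3) S4) (g : Γ) :
    orderOf g ≠ 8 := by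
  obtain ⟨f, -, ⟨i⟩, K, hK⟩ := h
  exact orderOf_ne_eight_of_isComplement' f le_rfl i hK g

theorem card_S4 : Nat.card S4 = 24 := by
  rw [Nat.card_perm, Nat.card_fin]; rfl

theorem card_ker_of_surjective {f : Γ →* S4} (hf : Function.Surjective f)
    (hcard : Nat.card Γ = 192) : Nat.card f.ker = 8 := by
  have h1 := f.ker.card_mul_index
  rw [Subgroup.index_ker, MonoidHom.range_eq_top.2 hf, hcard,
    Subgroup.card_top, card_S4] at h1
  omega

theorem isExtension_of_surjective {f : Γ →* S4} (hf : Function.Surjective f)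
    (hcard : Nat.card Γ = 192) (hsq : ∀ x ∈ f.ker, x * x = 1) :
    IsExtension Γ (ElemAb 3) S4 :=
  ⟨f, hf, nonempty_mulEquiv_elemAb (card_ker_of_surjective hf hcard) fun x =>
    Subtype.ext (hsq x x.2)⟩

theorem isNonsplitExtension_of_surjective {f : Γ →* S4} (hf : Function.Surjective f)
    (hcard : Nat.card Γ = 192) (hsq : ∀ x ∈ f.ker, x * x = 1) {g : Γ} (hg : orderOf g = 8) :
    IsNonsplitExtension Γ (ElemAb 3) S4 :=
  ⟨isExtension_of_surjective hf hcard hsq, fun h => h.orderOf_ne_eight g hg⟩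

/-- A group of order `192` that is an extension of an elementary abelian group by `S₄` and has a
sign character `ε` that is nontrivial on this elementary abelian group has the shape `A.S₄:2`,
with `ker ε` as the extension of a four-group by `S₄`. -/
theorem hasShapeFourS4Two_of_surjective {f : Γ →* S4} (hf : Function.Surjective f)
    (hcard : Nat.card Γ = 192) (hsq : ∀ x ∈ f.ker, x * x = 1) (ε : Γ →* ℤˣ) {z : Γ}
    (hz : z ∈ f.ker) (hεz : ε z = -1) {split : Prop}
    (hsplit : ∀ g : ε.ker →* S4, g = f.comp ε.ker.subtype → Nonempty (g.ker ≃* ElemAb 2) →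
      Function.Surjective g → ((∃ K, g.ker.IsComplement' K) ↔ split)) :
    HasShapeFourS4Two Γ split := by
  have : Finite Γ := Nat.finite_of_card_ne_zero (by omega)
  have hεz2 : ∀ g, ε g ≠ 1 → ε (g * z) = 1 := fun g hg => by
    rw [map_mul, hεz]
    rcases Int.units_eq_one_or (ε g) with h | h
    · exact absurd h hg
    · rw [h]; rfl
  have hH : Nat.card ε.ker * 2 = 192 := by
    have h1 := ε.ker.card_mul_index
    have h2 : ε.range = ⊤ := by
      rw [eq_top_iff]
      rintro u -
      rcases Int.units_eq_one_or u with rfl | rfl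
      exacts [one_mem _, ⟨z, hεz⟩]
    have h3 : Nat.card ℤˣ = 2 := by rw [Nat.card_eq_fintype_card, Fintype.card_units_int]
    rwa [Subgroup.index_ker, h2, hcard, Subgroup.card_top, h3] at h1
  -- multiplication by `z` moves an element into `ker ε` without changing its image under `f`
  have hsurj : Function.Surjective (f.comp ε.ker.subtype) := by
    intro p
    obtain ⟨g, rfl⟩ := hf p
    by_cases hg : ε g = 1
    · exact ⟨⟨g, hg⟩, rfl⟩
    · refine ⟨⟨g * z, hεz2 g hg⟩, ?_⟩
      simp [f.mem_ker.1 hz]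
  have hker : (f.comp ε.ker.subtype).ker = (f.ker ⊓ ε.ker).subgroupOf ε.ker := by
    ext x
    simp [MonoidHom.mem_ker, Subgroup.mem_subgroupOf]
  have hcardV : Nat.card (f.comp ε.ker.subtype).ker = 2 ^ 2 := by
    have h1 := (f.comp ε.ker.subtype).ker.card_mul_index
    rw [Subgroup.index_ker, MonoidHom.range_eq_top.2 hsurj,
      Subgroup.card_top, card_S4] at h1
    omega
  have hV : Nonempty ((f.comp ε.ker.subtype).ker ≃* ElemAb 2) :=
    nonempty_mulEquiv_elemAb hcardV fun x => Subtype.ext (Subtype.ext (hsq x.1.1 x.2))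
  refine ⟨f.ker ⊓ ε.ker, ε.ker, inferInstance, inferInstance, inf_le_right, ?_,
    ⟨f.comp ε.ker.subtype, hsurj, hker⟩, ?_, Subgroup.zpowers z, ?_, ?_⟩
  · obtain ⟨i⟩ := hV
    exact ⟨((Subgroup.subgroupOfEquivOfLe inf_le_right).symm.trans
      (MulEquiv.subgroupCongr hker.symm)).trans i⟩
  · rw [← hker]
    exact hsplit _ rfl hV hsurj
  · rw [Nat.card_zpowers]
    refine orderOf_eq_prime (by rw [pow_two]; exact hsq z hz) fun h => ?_
    rw [h, map_one] at hεz
    exact absurd hεz (by decide)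
  · have hz2 : Nat.card (Subgroup.zpowers z) = 2 := by
      rw [Nat.card_zpowers]
      refine orderOf_eq_prime (by rw [pow_two]; exact hsq z hz) fun h => ?_
      rw [h, map_one] at hεz
      exact absurd hεz (by decide)
    refine Subgroup.isComplement'_of_card_mul_and_disjoint (by rw [hz2, hH, hcard]) ?_
    rw [Subgroup.disjoint_def]
    intro x hx hxz
    obtain ⟨k, rfl⟩ := Subgroup.mem_zpowers_iff.1 hxz
    rcases Int.even_or_odd k with ⟨l, rfl⟩ | ⟨l, rfl⟩
    · rw [← two_mul, zpow_mul, zpow_two, hsq z hz, one_zpow]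
    · rw [MonoidHom.mem_ker, map_zpow, hεz, Odd.neg_one_zpow ⟨l, rfl⟩] at hx
      exact absurd hx (by decide)

/-- A complement of `N` that is contained in `H` is a complement of `N ⊓ H` in `H`. -/
theorem isComplement'_subgroupOf {N K H : Subgroup Γ} (h : N.IsComplement' K) (hK : K ≤ H) :
    (N.subgroupOf H).IsComplement' (K.subgroupOf H) := by
  refine Subgroup.isComplement'_of_disjoint_and_mul_eq_univ ?_ ?_
  · rw [Subgroup.disjoint_def]
    intro x hx hx'
    exact Subtype.ext (Subgroup.disjoint_def.1 h.disjoint hx hx')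
  · refine Set.eq_univ_of_forall fun x => ?_
    obtain ⟨⟨⟨n, hn⟩, ⟨k, hk⟩⟩, hnk, -⟩ := h.existsUnique x.1
    have hnk : n * k = x := hnk
    have hnH : n ∈ H := by
      rw [← mul_inv_eq_iff_eq_mul.2 hnk.symm]
      exact mul_mem x.2 (inv_mem (hK hk))
    exact Set.mem_mul.2 ⟨⟨n, hnH⟩, hn, ⟨k, hK hk⟩, hk, Subtype.ext hnk⟩

theorem isComplement'_range_inl_inr {N Q : Type} [Group N] [Group Q] (α : Q →* MulAut N) :
    (SemidirectProduct.inl : N →* N ⋊[α] Q).range.IsComplement'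
      (SemidirectProduct.inr : Q →* N ⋊[α] Q).range := by
  refine Subgroup.isComplement'_of_disjoint_and_mul_eq_univ ?_ ?_
  · rw [Subgroup.disjoint_def]
    rintro _ ⟨n, rfl⟩ ⟨q, hq⟩
    have h := congrArg SemidirectProduct.left hq
    rw [SemidirectProduct.left_inr, SemidirectProduct.left_inl] at h
    rw [← h, map_one]
  · refine Set.eq_univ_of_forall fun x => Set.mem_mul.2 ?_
    exact ⟨_, ⟨x.left, rfl⟩, _, ⟨x.right, rfl⟩, SemidirectProduct.inl_left_mul_inr_right x⟩

end Extensions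

/-! ### Diagonal sign changes -/

section SignChanges

/-- The permutation of the indices that is induced by a signed permutation. -/
def indexHom : oddPerms →* Perm (Fin 7) :=
  MonoidHom.toHomPerm
    { toFun := fun g i => (g.1 (1, i)).2
      map_one' := rfl
      map_mul' := fun g h => by
        funext i
        change (g.1 (h.1 (1, i))).2 = (g.1 (1, (h.1 (1, i)).2)).2
        rw [apply_eq_of_mem_oddPerms g.2] }

theorem indexHom_apply (g : oddPerms) (i : Fin 7) : indexHom g i = (g.1 (1, i)).2 := rfl

theorem indexHom_signedPerm (σ : Perm (Fin 7)) (M : Finset (Fin 7)) :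
    indexHom ⟨signedPerm σ M, signedPerm_mem_oddPerms σ M⟩ = σ := rfl

/-- The signed permutations without sign changes. -/
def permHom : Perm (Fin 7) →* oddPerms where
  toFun σ := ⟨signedPerm σ ∅, signedPerm_mem_oddPerms σ ∅⟩
  map_one' := by ext x <;> simp [signedPerm]
  map_mul' σ τ := by ext x <;> simp [signedPerm]

theorem indexHom_permHom (σ : Perm (Fin 7)) : indexHom (permHom σ) = σ := rfl

theorem apply_eq_of_indexHom_eq_one {d : oddPerms} (hd : indexHom d = 1) (x : ℤˣ × Fin 7) :
    d.1 x = (x.1 * (d.1 (1, x.2)).1, x.2) := by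
  rw [apply_eq_of_mem_oddPerms d.2 x, ← indexHom_apply, hd]
  rfl

theorem mul_comm_of_indexHom_eq_one {d e : oddPerms} (hd : indexHom d = 1) (he : indexHom e = 1) :
    d * e = e * d := by
  refine Subtype.ext (Equiv.ext fun x => ?_)
  change d.1 (e.1 x) = e.1 (d.1 x)
  have hd' : ∀ u, d.1 (u, x.2) = _ := fun u => apply_eq_of_indexHom_eq_one hd (u, x.2)
  have he' : ∀ u, e.1 (u, x.2) = _ := fun u => apply_eq_of_indexHom_eq_one he (u, x.2)
  rw [apply_eq_of_indexHom_eq_one he x, apply_eq_of_indexHom_eq_one hd x, hd' (_ * _), he' (_ * _),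
    mul_right_comm]

theorem mul_self_of_indexHom_eq_one {d : oddPerms} (hd : indexHom d = 1) : d * d = 1 := by
  refine Subtype.ext (Equiv.ext fun x => ?_)
  change d.1 (d.1 x) = x
  rw [apply_eq_of_indexHom_eq_one hd x, apply_eq_of_indexHom_eq_one hd, mul_assoc,
    Int.units_mul_self, mul_one]

/-- Conjugation of sign changes by a signed permutation depends only on the underlying permutation
of the indices. -/
theorem permHom_conj {g e : oddPerms} (he : indexHom e = 1) :
    permHom (indexHom g) * e * (permHom (indexHom g))⁻¹ = g * e * g⁻¹ := by
  obtain ⟨d, hd⟩ : ∃ d, g = permHom (indexHom g) * d := ⟨_, (mul_inv_cancel_left _ _).symm⟩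
  have hd1 : indexHom d = 1 := by
    have h := congrArg indexHom hd
    rw [map_mul, indexHom_permHom] at h
    exact left_eq_mul.1 h
  calc permHom (indexHom g) * e * (permHom (indexHom g))⁻¹
      = permHom (indexHom g) * (e * d * d⁻¹) * (permHom (indexHom g))⁻¹ := by
        rw [mul_inv_cancel_right]
    _ = permHom (indexHom g) * d * e * (permHom (indexHom g) * d)⁻¹ := by
        rw [mul_comm_of_indexHom_eq_one he hd1]; group
    _ = g * e * g⁻¹ := by rw [← hd]

/-- The generators `N₁`, `N₂`, `N₇` of `E`. -/
def signChanges : List (Perm (ℤˣ × Fin 7)) :=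
  [signedPerm 1 {4, 5, 6, 7}, signedPerm 1 {2, 3, 5, 6}, signedPerm 1 {1, 3, 5, 7}]

theorem signChanges_subset_oddPerms : ∀ s ∈ signChanges, s ∈ oddPerms := by
  simp [signChanges, signedPerm_mem_oddPerms]

theorem E_eq_closure : E = Subgroup.closure {s | s ∈ signChanges} := by
  rw [E]
  congr 1
  ext s
  simp [signChanges]

theorem length_groupCodes_signChanges :
    IsClosedList signChanges ∧ (groupCodes signChanges).length = 8 := by decide +kernel

theorem card_E : Nat.card E = 8 := by
  rw [E_eq_closure, card_closure signChanges_subset_oddPerms length_groupCodes_signChanges.1,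
    length_groupCodes_signChanges.2]

theorem E_le : E ≤ indexHom.ker.map oddPerms.subtype := by
  rw [E_eq_closure, Subgroup.closure_le]
  have h : ∀ M, signedPerm 1 M ∈ indexHom.ker.map oddPerms.subtype := fun M =>
    ⟨⟨_, signedPerm_mem_oddPerms 1 M⟩, indexHom_signedPerm 1 M, rfl⟩
  intro s hs
  simp only [signChanges, List.mem_cons, List.not_mem_nil, or_false, Set.mem_ofPred_eq] at hs
  rcases hs with rfl | rfl | rfl <;> exact h _

theorem E_le_oddPerms : E ≤ oddPerms := fun e he => by
  obtain ⟨d, -, rfl⟩ := E_le he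
  exact d.2

theorem indexHom_of_mem_E {e : Perm (ℤˣ × Fin 7)} (he : e ∈ E) :
    indexHom ⟨e, E_le_oddPerms he⟩ = 1 := by
  obtain ⟨d, hd, rfl⟩ := E_le he
  exact hd

theorem mul_self_of_mem_E {e : Perm (ℤˣ × Fin 7)} (he : e ∈ E) : e * e = 1 :=
  congrArg Subtype.val (mul_self_of_indexHom_eq_one (indexHom_of_mem_E he))

/-- The points of the Fano plane are separated by the sets of sign changes in `E`, hence a signed
permutation that centralizes `E` is diagonal. -/
theorem indexHom_eq_one_of_commute {g : oddPerms} (hg : ∀ e ∈ E, g.1 * e = e * g.1) :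
    indexHom g = 1 := by
  have key : ∀ M, signedPerm 1 M ∈ E → ∀ i, i ∈ M ↔ indexHom g i ∈ M := by
    intro M hM i
    have h := congrArg Prod.fst (Equiv.congr_fun (hg _ hM) (1, i))
    rw [Perm.mul_apply, Perm.mul_apply, apply_eq_of_mem_oddPerms g.2] at h
    have h' : (1 * (if i ∈ M then -1 else 1)) * (g.1 (1, i)).1 =
      (g.1 (1, i)).1 * (if indexHom g i ∈ M then -1 else 1) := h
    rw [one_mul, mul_comm, mul_right_inj] at h'
    by_cases h1 : i ∈ M <;> by_cases h2 : indexHom g i ∈ M <;> simp_all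
  have hsep : ∀ i j : Fin 7,
      (i ∈ ({4, 5, 6, 7} : Finset (Fin 7)) ↔ j ∈ ({4, 5, 6, 7} : Finset (Fin 7))) →
      (i ∈ ({2, 3, 5, 6} : Finset (Fin 7)) ↔ j ∈ ({2, 3, 5, 6} : Finset (Fin 7))) →
      (i ∈ ({1, 3, 5, 7} : Finset (Fin 7)) ↔ j ∈ ({1, 3, 5, 7} : Finset (Fin 7))) → i = j := by
    decide
  ext1 i
  exact (hsep _ _ (key _ (Subgroup.subset_closure (by simp)) i)
    (key _ (Subgroup.subset_closure (by simp)) i)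
    (key _ (Subgroup.subset_closure (by simp)) i)).symm

end SignChanges

/-! ### Extensions of `E` by signed permutations, and their split versions -/

section MonomialExtensions

/-- The signed permutations that are given by a list of pairs of a permutation and a set of
signs. -/
def signedPerms (gens : List (Perm (Fin 7) × Finset (Fin 7))) : List (Perm (ℤˣ × Fin 7)) :=
  gens.map fun p => signedPerm p.1 p.2

/-- The generators of the split version of the group generated by `signedPerms gens`: those of `E`,
and the given permutations without signs. -/
def splitPerms (gens : List (Perm (Fin 7) × Finset (Fin 7))) : List (Perm (ℤˣ × Fin 7)) :=
  signChanges ++ gens.map fun p => signedPerm p.1 ∅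

/-- Whether the signed permutation with code `c` maps the blocks of the sets of indices in `L`
to themselves. -/
def fixesBlocks (L : Finset (Finset (Fin 7))) (c : ℕ) : Bool :=
  decide (∀ l ∈ L, ∀ i ∈ l, Fin.ofNat 7 (c / 14 ^ (i : ℕ) % 14) ∈ l)

/-- The signed permutations in `gens` generate a group `G` of order `192` that normalizes `E`, and
`E` is the kernel of the action of `G` on a family of four blocks.  The conditions are such that
they can be decided by computation, most of them as statements about codes. -/
structure IsMonomialExtension (G : Subgroup (Perm (ℤˣ × Fin 7)))
    (gens : List (Perm (Fin 7) × Finset (Fin 7))) (L : Finset (Finset (Fin 7))) : Prop where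
  eq_closure : G = Subgroup.closure {s | s ∈ signedPerms gens}
  closed : IsClosedList (signedPerms gens)
  length : (groupCodes (signedPerms gens)).length = 192
  le : (signChanges.all fun s => memCode (code s) (groupCodes (signedPerms gens))) = true
  conj : ((signedPerms gens).all fun s => signChanges.all fun t =>
    memCode (code (s * t * s⁻¹)) (groupCodes signChanges)) = true
  card_blocks : (blocks L).card = 4
  stabilizes : ∀ s ∈ signedPerms gens, s ∈ familyStabilizer (blocks L)
  kernel : ((groupCodes (signedPerms gens)).all fun c =>
    !fixesBlocks L c || memCode c (groupCodes signChanges)) = true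
  closed_split : IsClosedList (splitPerms gens)
  length_split : (groupCodes (splitPerms gens)).length = 192

theorem signedPerms_subset_oddPerms {gens : List (Perm (Fin 7) × Finset (Fin 7))} :
    ∀ s ∈ signedPerms gens, s ∈ oddPerms := by
  intro s hs
  obtain ⟨p, -, rfl⟩ := List.mem_map.1 hs
  exact signedPerm_mem_oddPerms _ _

theorem splitPerms_subset_oddPerms {gens : List (Perm (Fin 7) × Finset (Fin 7))} :
    ∀ s ∈ splitPerms gens, s ∈ oddPerms := by
  intro s hs
  rcases List.mem_append.1 hs with hs | hs
  · exact signChanges_subset_oddPerms s hs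
  · obtain ⟨p, -, rfl⟩ := List.mem_map.1 hs
    exact signedPerm_mem_oddPerms _ _

theorem mul_self_of_mem_ker {G : Subgroup (Perm (ℤˣ × Fin 7))} {f : G →* S4}
    (hf : f.ker = E.subgroupOf G) : ∀ x ∈ f.ker, x * x = 1 := by
  intro x hx
  rw [hf] at hx
  exact Subtype.ext (mul_self_of_mem_E hx)

namespace IsMonomialExtension

variable {G : Subgroup (Perm (ℤˣ × Fin 7))} {gens : List (Perm (Fin 7) × Finset (Fin 7))}
  {L : Finset (Finset (Fin 7))} (h : IsMonomialExtension G gens L)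
include h

theorem le_oddPerms : G ≤ oddPerms := by
  rw [h.eq_closure]
  exact closure_le_oddPerms signedPerms_subset_oddPerms

theorem card : Nat.card G = 192 := by
  rw [h.eq_closure, card_closure signedPerms_subset_oddPerms h.closed, h.length]

theorem E_le : E ≤ G := by
  have hle := h.le
  simp only [List.all_eq_true, memCode_eq_true] at hle
  rw [h.eq_closure, E_eq_closure, Subgroup.closure_le]
  exact fun s hs => mem_closure_of_code_mem signedPerms_subset_oddPerms
    (signChanges_subset_oddPerms s hs) (hle s hs)

theorem le_normalizer : G ≤ Subgroup.normalizer (E : Set (Perm (ℤˣ × Fin 7))) := by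
  have hconj := h.conj
  simp only [List.all_eq_true, memCode_eq_true] at hconj
  have key : ∀ s ∈ signedPerms gens, E ≤ E.comap (MulAut.conj s).toMonoidHom := by
    intro s hs
    conv_lhs => rw [E_eq_closure]
    rw [Subgroup.closure_le]
    intro t ht
    have hso := signedPerms_subset_oddPerms s hs
    change s * t * s⁻¹ ∈ E
    rw [E_eq_closure]
    exact mem_closure_of_code_mem signChanges_subset_oddPerms
      (mul_mem (mul_mem hso (signChanges_subset_oddPerms t ht)) (inv_mem hso)) (hconj s hs t ht)
  rw [h.eq_closure, Subgroup.closure_le]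
  intro s hs
  exact Subgroup.mem_normalizer_fintype fun n hn => key s hs hn

theorem normal : (E.subgroupOf G).Normal :=
  Subgroup.normal_subgroupOf_of_le_normalizer h.le_normalizer

theorem mem_E {g : Perm (ℤˣ × Fin 7)} (hg : g ∈ G)
    (hL : ∀ l ∈ L, ∀ i ∈ l, (g (1, i)).2 ∈ l) : g ∈ E := by
  have hkernel := h.kernel
  simp only [List.all_eq_true, Bool.or_eq_true, Bool.not_eq_true', memCode_eq_true] at hkernel
  rw [E_eq_closure]
  refine mem_closure_of_code_mem signChanges_subset_oddPerms (h.le_oddPerms hg) ?_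
  refine (hkernel (code g) (code_mem_groupCodes signedPerms_subset_oddPerms h.closed
    (h.eq_closure ▸ hg))).resolve_left ?_
  have hcode : ∀ x, Fin.ofNat 7 (unitCode x) = x.2 := by decide +kernel
  rw [Bool.not_eq_false, fixesBlocks, decide_eq_true_eq]
  intro l hl i hi
  rw [code_div_mod, hcode]
  exact hL l hl i hi

theorem exists_surjective :
    ∃ f : G →* S4, Function.Surjective f ∧ f.ker = E.subgroupOf G := by
  have hfam : ∀ g : G, G.subtype g ∈ familyStabilizer (blocks L) := by
    have : G ≤ familyStabilizer (blocks L) := by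
      rw [h.eq_closure, Subgroup.closure_le]; exact h.stabilizes
    exact fun g => this g.2
  let F := familyHom G.subtype (blocks L) hfam
  have hF : F.ker = E.subgroupOf G := by
    ext g
    rw [MonoidHom.mem_ker, Subgroup.mem_subgroupOf]
    constructor
    · intro hg
      refine h.mem_E g.2 ?_
      intro l hl i hi
      have hb : Finset.univ ×ˢ l ∈ blocks L := Finset.mem_image_of_mem _ hl
      have hgl := congrArg Subtype.val (Equiv.congr_fun hg ⟨_, hb⟩)
      have hgl : (Finset.univ ×ˢ l).image g.1 = Finset.univ ×ˢ l := hgl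
      have hmem : g.1 (1, i) ∈ (Finset.univ ×ˢ l : Finset (ℤˣ × Fin 7)) := by
        rw [← hgl]; exact Finset.mem_image_of_mem _ (by simp [hi])
      exact (Finset.mem_product.1 hmem).2
    · intro hg
      ext1 ⟨s, hs⟩
      obtain ⟨l, hl, rfl⟩ := Finset.mem_image.1 hs
      refine Subtype.ext (Finset.eq_of_subset_of_card_le ?_ ?_)
      · intro y hy
        obtain ⟨x, hx, rfl⟩ := Finset.mem_image.1 hy
        have hx' := apply_eq_of_indexHom_eq_one (indexHom_of_mem_E hg) x
        change g.1 x ∈ _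
        rw [hx']
        exact Finset.mem_product.2 ⟨Finset.mem_univ _, (Finset.mem_product.1 hx).2⟩
      · exact (Finset.card_image_of_injective _ g.1.injective).ge
  let e : {s // s ∈ blocks L} ≃ Fin 4 :=
    Fintype.equivFinOfCardEq (by rw [Fintype.card_coe, h.card_blocks])
  let f : G →* S4 := e.permCongrHom.toMonoidHom.comp F
  have hf : f.ker = E.subgroupOf G := by
    rw [← hF]
    ext g
    rw [MonoidHom.mem_ker, MonoidHom.mem_ker]
    exact map_eq_one_iff e.permCongrHom e.permCongrHom.injective
  refine ⟨f, ?_, hf⟩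
  have hcard := f.ker.card_mul_index
  rw [Subgroup.index_ker, hf, Nat.card_congr (Subgroup.subgroupOfEquivOfLe h.E_le).toEquiv, card_E,
    h.card] at hcard
  exact MonoidHom.range_eq_top.1 (Subgroup.eq_top_of_card_eq _ (by rw [card_S4]; omega))

/-- The conjugation action of `G` on `E`. -/
theorem exists_conjHom : ∃ c : G →* inducedAut G, Function.Surjective c ∧
    c.ker = E.subgroupOf G ∧ ∀ g (e : E), ((c g : MulAut E) e : Perm (ℤˣ × Fin 7)) =
      g * e * (g : Perm (ℤˣ × Fin 7))⁻¹ := by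
  let c₀ : G →* MulAut E := E.normalizerMonoidHom.comp (Subgroup.inclusion h.le_normalizer)
  have hc₀ : ∀ g, c₀ g ∈ inducedAut G := fun g => ⟨_, g.2, rfl⟩
  have happ : ∀ g (e : E), (c₀ g e : Perm (ℤˣ × Fin 7)) =
      g * e * (g : Perm (ℤˣ × Fin 7))⁻¹ := fun g e => rfl
  refine ⟨c₀.codRestrict _ hc₀, ?_, ?_, happ⟩
  · rintro ⟨_, n, hn, rfl⟩
    exact ⟨⟨n, hn⟩, rfl⟩
  · ext g
    rw [MonoidHom.ker_codRestrict, MonoidHom.mem_ker, Subgroup.mem_subgroupOf]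
    constructor
    · intro hg
      have h1 : indexHom ⟨g, h.le_oddPerms g.2⟩ = 1 := by
        refine indexHom_eq_one_of_commute fun e he => ?_
        have h2 := happ g ⟨e, he⟩
        rw [hg] at h2
        exact (eq_mul_inv_iff_mul_eq.1 h2).symm
      refine h.mem_E g.2 fun l _ i hi => ?_
      have h3 : (g.1 (1, i)).2 = i := Equiv.congr_fun h1 i
      rwa [h3]
    · intro hg
      ext1 e
      refine Subtype.ext ?_
      rw [happ]
      have h1 := congrArg Subtype.val
        (mul_comm_of_indexHom_eq_one (indexHom_of_mem_E hg) (indexHom_of_mem_E e.2))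
      exact mul_inv_eq_iff_eq_mul.2 h1

theorem nonempty_inducedAut_mulEquiv : Nonempty (inducedAut G ≃* S4) := by
  obtain ⟨f, hf, hfker⟩ := h.exists_surjective
  obtain ⟨c, hc, hcker, -⟩ := h.exists_conjHom
  exact ⟨(QuotientGroup.quotientKerEquivOfSurjective c hc).symm.trans
    ((QuotientGroup.quotientMulEquivOfEq (hcker.trans hfker.symm)).trans
      (QuotientGroup.quotientKerEquivOfSurjective f hf))⟩

theorem card_splitVersion : Nat.card (SplitVersion G) = 192 := by
  obtain ⟨e⟩ := h.nonempty_inducedAut_mulEquiv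
  rw [Nat.card_congr SemidirectProduct.equivProd, Nat.card_prod, card_E, Nat.card_congr e.toEquiv,
    card_S4]

theorem exists_surjective_split : ∃ f : SplitVersion G →* S4, Function.Surjective f ∧
    f.ker = (SemidirectProduct.inl : E →* SplitVersion G).range := by
  obtain ⟨e⟩ := h.nonempty_inducedAut_mulEquiv
  refine ⟨e.toMonoidHom.comp SemidirectProduct.rightHom,
    e.surjective.comp SemidirectProduct.rightHom_surjective, ?_⟩
  rw [SemidirectProduct.range_inl_eq_ker_rightHom]
  ext x
  rw [MonoidHom.mem_ker, MonoidHom.mem_ker]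
  exact map_eq_one_iff e e.injective

/-- The split version of `G` is realized by signed permutations: a sign change is mapped to itself,
and the automorphism of `E` induced by `g ∈ G` is mapped to the permutation underlying `g`. -/
theorem exists_splitModel : ∃ φ : SplitVersion G →* Perm (ℤˣ × Fin 7), Function.Injective φ ∧
    φ.range = Subgroup.closure {s | s ∈ splitPerms gens} ∧
    (∀ e : E, φ (SemidirectProduct.inl e) = e) ∧
    ∀ a, ∃ σ : Perm (Fin 7), φ (SemidirectProduct.inr a) = permHom σ := by
  obtain ⟨c, hc, hcker, happ⟩ := h.exists_conjHom
  let ι : G →* oddPerms := Subgroup.inclusion h.le_oddPerms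
  have hle : c.ker ≤ ((permHom.comp indexHom).comp ι).ker := by
    intro g hg
    rw [hcker] at hg
    have h1 : indexHom (ι g) = 1 := indexHom_of_mem_E hg
    rw [MonoidHom.mem_ker, MonoidHom.comp_apply, MonoidHom.comp_apply, h1, map_one]
  let s : inducedAut G →* oddPerms := c.liftOfSurjective hc ⟨_, hle⟩
  have hs : ∀ g, s (c g) = permHom (indexHom (ι g)) := fun g =>
    c.liftOfRightInverse_comp_apply _ _ _ g
  let φ : SplitVersion G →* Perm (ℤˣ × Fin 7) :=
    SemidirectProduct.lift E.subtype (oddPerms.subtype.comp s) fun a => by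
      obtain ⟨g, rfl⟩ := hc a
      ext1 e
      have h1 := congrArg Subtype.val (permHom_conj (g := ι g) (indexHom_of_mem_E e.2))
      rw [← hs] at h1
      exact (happ g e).trans h1.symm
  have hinl : ∀ e : E, φ (SemidirectProduct.inl e) = e := fun e =>
    SemidirectProduct.lift_inl _ _ _ e
  have hinr : ∀ g, φ (SemidirectProduct.inr (c g)) = permHom (indexHom (ι g)) := fun g => by
    rw [SemidirectProduct.lift_inr, MonoidHom.comp_apply, hs]; rfl
  have hinj : Function.Injective φ := by
    rw [injective_iff_map_eq_one]
    intro x hx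
    obtain ⟨g, hg⟩ := hc x.right
    have hx' : x = SemidirectProduct.inl x.left * SemidirectProduct.inr x.right :=
      (SemidirectProduct.inl_left_mul_inr_right x).symm
    rw [hx', ← hg, map_mul, hinl, hinr] at hx
    have h1 : (⟨x.left, E_le_oddPerms x.left.2⟩ : oddPerms) * permHom (indexHom (ι g)) = 1 :=
      Subtype.ext hx
    have h2 := congrArg indexHom h1
    rw [map_mul, indexHom_of_mem_E x.left.2, one_mul, indexHom_permHom, map_one] at h2
    have h3 : x.left = 1 := by
      rw [h2, map_one, mul_one] at h1
      have h4 : (x.left : Perm (ℤˣ × Fin 7)) = 1 := congrArg Subtype.val h1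
      exact Subtype.ext h4
    have h4 : x.right = 1 := by
      rw [← hg, ← MonoidHom.mem_ker, hcker]
      refine h.mem_E g.2 fun l _ i hi => ?_
      have h5 : (g.1 (1, i)).2 = i := Equiv.congr_fun h2 i
      change (g.1 (1, i)).2 ∈ l
      rwa [h5]
    rw [hx', h3, h4, map_one, map_one, one_mul]
  refine ⟨φ, hinj, ?_, hinl, fun a => ?_⟩
  · have hle : Subgroup.closure {s | s ∈ splitPerms gens} ≤ φ.range := by
      rw [Subgroup.closure_le]
      intro t ht
      rcases List.mem_append.1 ht with ht | ht
      · exact ⟨_, hinl ⟨t, E_eq_closure ▸ Subgroup.subset_closure ht⟩⟩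
      · obtain ⟨p, hp, rfl⟩ := List.mem_map.1 ht
        have hpG : signedPerm p.1 p.2 ∈ G := by
          rw [h.eq_closure]
          exact Subgroup.subset_closure (List.mem_map.2 ⟨p, hp, rfl⟩)
        exact ⟨_, hinr ⟨_, hpG⟩⟩
    refine (Subgroup.eq_of_le_of_card_ge hle ?_).symm
    rw [card_closure splitPerms_subset_oddPerms h.closed_split, h.length_split,
      ← h.card_splitVersion]
    exact (Nat.card_congr (MonoidHom.ofInjective hinj).toEquiv).ge
  · obtain ⟨g, rfl⟩ := hc a
    exact ⟨_, hinr g⟩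

theorem isSplitExtension : IsSplitExtension (SplitVersion G) (ElemAb 3) S4 := by
  obtain ⟨f, hf, hker⟩ := h.exists_surjective_split
  refine ⟨f, hf, nonempty_mulEquiv_elemAb (card_ker_of_surjective hf h.card_splitVersion) ?_,
    _, hker ▸ isComplement'_range_inl_inr _⟩
  rintro ⟨x, hx⟩
  rw [hker] at hx
  obtain ⟨e, rfl⟩ := hx
  refine Subtype.ext ?_
  change SemidirectProduct.inl e * SemidirectProduct.inl e = 1
  have he : e * e = 1 := Subtype.ext (mul_self_of_mem_E e.2)
  rw [← map_mul, he, map_one]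

theorem isNonsplitExtension {g : Perm (ℤˣ × Fin 7)} (hg : g ∈ G) (hord : orderOf g = 8) :
    IsNonsplitExtension G (ElemAb 3) S4 := by
  obtain ⟨f, hf, hker⟩ := h.exists_surjective
  exact isNonsplitExtension_of_surjective hf h.card (mul_self_of_mem_ker hker)
    (g := ⟨g, hg⟩) (by rw [← hord, Subgroup.orderOf_mk])

theorem isEmpty_mulEquiv {g : Perm (ℤˣ × Fin 7)} (hg : g ∈ G) (hord : orderOf g = 8) :
    IsEmpty (G ≃* SplitVersion G) :=
  ⟨fun e => h.isSplitExtension.orderOf_ne_eight (e ⟨g, hg⟩) (by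
    rw [MulEquiv.orderOf_eq, Subgroup.orderOf_mk, hord])⟩

end IsMonomialExtension

end MonomialExtensions

/-! ### The sign character on the axis of `e₆` -/

section Shapes

/-- The sign with which signed permutations that preserve the axis of `e₆` act on it. -/
theorem exists_signHom {Γ : Type} [Group Γ] (φ : Γ →* Perm (ℤˣ × Fin 7))
    (hodd : ∀ g, φ g ∈ oddPerms) (hfix : ∀ g, (φ g (1, 6)).2 = 6) :
    ∃ ε : Γ →* ℤˣ, ∀ g, ε g = (φ g (1, 6)).1 := by
  refine ⟨MonoidHom.mk' (fun g => (φ g (1, 6)).1) fun g k => ?_, fun g => rfl⟩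
  rw [map_mul, Perm.mul_apply, apply_eq_of_mem_oddPerms (hodd g), hfix, mul_comm]

/-- The sign change `N₁`, which is nontrivial on `e₆`. -/
theorem signedPerm_one_mem_E : signedPerm 1 {4, 5, 6, 7} ∈ E := Subgroup.subset_closure (by simp)

theorem sign_six : (signedPerm 1 {4, 5, 6, 7} (1, 6)).1 = -1 := by decide

namespace IsMonomialExtension

variable {G : Subgroup (Perm (ℤˣ × Fin 7))} {gens : List (Perm (Fin 7) × Finset (Fin 7))}
  {L : Finset (Finset (Fin 7))} (h : IsMonomialExtension G gens L)
include h

theorem hasShapeFourS4Two (h6 : ∀ g ∈ G, (g (1, 6)).2 = 6) {g : Perm (ℤˣ × Fin 7)} (hg : g ∈ G)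
    (hord : orderOf g = 8) (hsign : (g (1, 6)).1 = 1) : HasShapeFourS4Two G False := by
  obtain ⟨f, hf, hker⟩ := h.exists_surjective
  obtain ⟨ε, hε⟩ := exists_signHom G.subtype (fun g => h.le_oddPerms g.2) fun g => h6 g g.2
  refine hasShapeFourS4Two_of_surjective hf h.card (mul_self_of_mem_ker hker) ε
    (z := ⟨_, h.E_le signedPerm_one_mem_E⟩) ?_ ?_ ?_
  · rw [hker]
    exact signedPerm_one_mem_E
  · rw [hε]
    exact sign_six
  · rintro k - ⟨i⟩ -
    rw [iff_false]
    rintro ⟨K, hK⟩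
    refine orderOf_ne_eight_of_isComplement' k (by omega) i hK
      ⟨⟨g, hg⟩, by rw [MonoidHom.mem_ker, hε]; exact hsign⟩ ?_
    rw [Subgroup.orderOf_mk, Subgroup.orderOf_mk, hord]

theorem hasShapeFourS4Two_splitVersion
    (h6 : ∀ g ∈ Subgroup.closure {s | s ∈ splitPerms gens}, (g (1, 6)).2 = 6) :
    HasShapeFourS4Two (SplitVersion G) True := by
  obtain ⟨f, hf, hker⟩ := h.exists_surjective_split
  obtain ⟨φ, -, hrange, hinl, hinr⟩ := h.exists_splitModel
  have hmem : ∀ g, φ g ∈ Subgroup.closure {s | s ∈ splitPerms gens} := fun g => hrange ▸ ⟨g, rfl⟩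
  obtain ⟨ε, hε⟩ := exists_signHom φ
    (fun g => closure_le_oddPerms splitPerms_subset_oddPerms (hmem g)) fun g => h6 _ (hmem g)
  refine hasShapeFourS4Two_of_surjective hf h.card_splitVersion ?_ ε
    (z := SemidirectProduct.inl ⟨_, signedPerm_one_mem_E⟩) ?_ ?_ ?_
  · intro x hx
    rw [hker] at hx
    obtain ⟨e, rfl⟩ := hx
    have he : e * e = 1 := Subtype.ext (mul_self_of_mem_E e.2)
    rw [← map_mul, he, map_one]
  · rw [hker]
    exact ⟨_, rfl⟩
  · rw [hε, hinl]
    exact sign_six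
  · rintro k rfl - -
    rw [iff_true]
    have hK := isComplement'_subgroupOf (H := ε.ker) (hker ▸ isComplement'_range_inl_inr _) (by
      rintro _ ⟨a, rfl⟩
      obtain ⟨σ, hσ⟩ := hinr a
      rw [MonoidHom.mem_ker, hε, hσ]
      rfl)
    exact ⟨_, hK⟩

end IsMonomialExtension

theorem apply_six_of_groupCodes {S : List (Perm (ℤˣ × Fin 7))} (hS : ∀ s ∈ S, s ∈ oddPerms)
    (hcl : IsClosedList S)
    (h6 : ((groupCodes S).all fun c => Nat.beq (c / 14 ^ 6 % 14 % 7) 6) = true)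
    {g : Perm (ℤˣ × Fin 7)} (hg : g ∈ Subgroup.closure {s | s ∈ S}) : (g (1, 6)).2 = 6 := by
  rw [List.all_eq_true] at h6
  have h1 := Nat.eq_of_beq_eq_true (h6 _ (code_mem_groupCodes hS hcl hg))
  have h2 : code g / 14 ^ 6 % 14 = unitCode (g (1, 6)) := code_div_mod g 6
  have h3 : ∀ x, unitCode x % 7 = 6 → x.2 = 6 := by decide +kernel
  rw [h2] at h1
  exact h3 _ h1

end Shapes

/-! ### The groups `4.S₄:2` and `4:S₄:2` -/

section FirstPair

/-- The permutations and signs of `γ` and `θ`. -/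
def gensV : List (Perm (Fin 7) × Finset (Fin 7)) :=
  [(swap 1 4 * swap 2 5, {1, 2, 3, 4, 5, 7}), (c[1, 5] * c[2, 3, 4, 7], {1, 2, 3, 4, 5, 6})]

/-- The permutations of the indices that underlie representatives of the conjugacy classes of
`4.S₄:2` and of `4:S₄:2`. -/
def cyclesV : Fin 14 → Perm (Fin 7) :=
  ![1, 1, 1, c[1, 7] * c[3, 5], c[1, 3] * c[5, 7], c[1, 5] * c[2, 4], c[1, 3, 4] * c[2, 5, 7],
    c[1, 7] * c[3, 5], c[1, 5] * c[2, 4], c[1, 5] * c[2, 4], c[1, 7] * c[3, 5],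
    c[1, 7, 2] * c[3, 4, 5], c[1, 7, 5, 3] * c[2, 4], c[1, 7, 5, 3] * c[2, 4]]

/-- Representatives of the conjugacy classes of `4.S₄:2`. -/
def repV (j : Fin 14) : Perm (ℤˣ × Fin 7) :=
  signedPerm (cyclesV j) (![{}, {1, 2, 4, 5}, {4, 5, 6, 7}, {4, 6}, {2, 4}, {6, 7}, {},
    {2, 3, 6, 7}, {1, 3, 4, 7}, {4, 5}, {1, 3}, {6, 7}, {3, 6}, {2, 5}] j)

/-- Representatives of the conjugacy classes of the model of `4:S₄:2` by signed permutations. -/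
def splitRepV (j : Fin 14) : Perm (ℤˣ × Fin 7) :=
  signedPerm (cyclesV j) (![{}, {1, 2, 4, 5}, {4, 5, 6, 7}, {1, 3, 4, 6}, {2, 3, 4, 7},
    {2, 3, 5, 6}, {}, {1, 2, 6, 7}, {2, 3, 4, 7}, {}, {}, {2, 3, 5, 6}, {2, 3, 5, 6}, {}] j)

theorem isMonomialExtension_fourS4Two : IsMonomialExtension fourS4Two gensV hexadLines where
  eq_closure := by
    rw [fourS4Two]
    congr 1
    ext s
    simp [signedPerms, gensV, γ, θ]
  closed := by decide +kernel
  length := by decide +kernel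
  le := by decide +kernel
  conj := by decide +kernel
  card_blocks := by decide +kernel
  stabilizes := by
    intro s hs
    simp only [signedPerms, gensV, List.map_cons, List.map_nil, List.mem_cons, List.not_mem_nil,
      or_false] at hs
    rcases hs with rfl | rfl <;> (change _ = _; decide +kernel)
  kernel := by decide +kernel
  closed_split := by decide +kernel
  length_split := by decide +kernel

/-- The generators of `4.S₄:2`, as well as those of the model of `4:S₄:2`, preserve the families
that enter into `invariantsV`. -/
theorem mem_familyStabilizer_familiesV : ∀ 𝓕 ∈ familiesV,
    ∀ s ∈ signedPerms gensV ++ splitPerms gensV, s ∈ familyStabilizer 𝓕 := by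
  intro 𝓕 h𝓕 s hs
  simp only [familiesV, List.mem_cons, List.not_mem_nil, or_false] at h𝓕
  simp only [signedPerms, splitPerms, signChanges, gensV, List.map_cons, List.map_nil,
    List.mem_append, List.mem_cons, List.not_mem_nil, or_false] at hs
  rcases h𝓕 with rfl | rfl | rfl | rfl | rfl | rfl | rfl <;>
    rcases hs with (rfl | rfl) | (rfl | rfl | rfl) | rfl | rfl <;>
    (change _ = _; decide +kernel)

theorem orderOf_repV (j : Fin 14) : orderOf (repV j) = ordVNonsplit j := by
  have h : ∀ j, 0 < ordVNonsplit j ∧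
      (mulCode (code (repV j)))^[ordVNonsplit j] (code 1) = code 1 ∧
      ∀ m < ordVNonsplit j, 0 < m → (mulCode (code (repV j)))^[m] (code 1) ≠ code 1 := by
    decide +kernel
  exact orderOf_eq_of_code (signedPerm_mem_oddPerms _ _) (h j).1 (h j).2.1 (h j).2.2

theorem orderOf_splitRepV (j : Fin 14) : orderOf (splitRepV j) = ordVSplit j := by
  have h : ∀ j, 0 < ordVSplit j ∧
      (mulCode (code (splitRepV j)))^[ordVSplit j] (code 1) = code 1 ∧
      ∀ m < ordVSplit j, 0 < m → (mulCode (code (splitRepV j)))^[m] (code 1) ≠ code 1 := by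
    decide +kernel
  exact orderOf_eq_of_code (signedPerm_mem_oddPerms _ _) (h j).1 (h j).2.1 (h j).2.2

theorem repV_mem (j : Fin 14) : repV j ∈ Subgroup.closure {s | s ∈ signedPerms gensV} := by
  have h : ∀ j, memCode (code (repV j)) (groupCodes (signedPerms gensV)) = true := by
    decide +kernel
  exact mem_closure_of_code_mem signedPerms_subset_oddPerms (signedPerm_mem_oddPerms _ _)
    (memCode_eq_true.1 (h j))

theorem splitRepV_mem (j : Fin 14) :
    splitRepV j ∈ Subgroup.closure {s | s ∈ splitPerms gensV} := by
  have h : ∀ j, memCode (code (splitRepV j)) (groupCodes (splitPerms gensV)) = true := by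
    decide +kernel
  exact mem_closure_of_code_mem splitPerms_subset_oddPerms (signedPerm_mem_oddPerms _ _)
    (memCode_eq_true.1 (h j))

theorem hasCharacterTable_fourS4Two : HasCharacterTable fourS4Two sizeV ordVNonsplit tableV :=
  hasCharacterTable_tableV (φ := fourS4Two.subtype) Subtype.val_injective
    (by rw [Subgroup.range_subtype]; exact isMonomialExtension_fourS4Two.eq_closure)
    signedPerms_subset_oddPerms isMonomialExtension_fourS4Two.card
    (fun 𝓕 h𝓕 s hs => mem_familyStabilizer_familiesV 𝓕 h𝓕 s (List.mem_append_left _ hs))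
    repV_mem (by decide +kernel) (by decide +kernel) orderOf_repV

theorem hasCharacterTable_splitVersion_fourS4Two :
    HasCharacterTable (SplitVersion fourS4Two) sizeV ordVSplit tableV := by
  obtain ⟨φ, hinj, hrange, -⟩ := isMonomialExtension_fourS4Two.exists_splitModel
  exact hasCharacterTable_tableV hinj hrange splitPerms_subset_oddPerms
    isMonomialExtension_fourS4Two.card_splitVersion
    (fun 𝓕 h𝓕 s hs => mem_familyStabilizer_familiesV 𝓕 h𝓕 s (List.mem_append_right _ hs))
    splitRepV_mem (by decide +kernel) (by decide +kernel) orderOf_splitRepV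

/-- An element of order `8` of `4.S₄:2` that fixes `e₆`. -/
theorem repV_thirteen : repV 13 ∈ fourS4Two ∧ orderOf (repV 13) = 8 ∧ (repV 13 (1, 6)).1 = 1 :=
  ⟨isMonomialExtension_fourS4Two.eq_closure ▸ repV_mem 13, orderOf_repV 13, by decide +kernel⟩

theorem hasShapeFourS4Two_fourS4Two : HasShapeFourS4Two fourS4Two False := by
  refine isMonomialExtension_fourS4Two.hasShapeFourS4Two (fun g hg => ?_) repV_thirteen.1
    repV_thirteen.2.1 repV_thirteen.2.2
  rw [isMonomialExtension_fourS4Two.eq_closure] at hg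
  exact apply_six_of_groupCodes signedPerms_subset_oddPerms isMonomialExtension_fourS4Two.closed
    (by decide +kernel) hg

theorem hasShapeFourS4Two_splitVersion_fourS4Two :
    HasShapeFourS4Two (SplitVersion fourS4Two) True :=
  isMonomialExtension_fourS4Two.hasShapeFourS4Two_splitVersion fun _ hg =>
    apply_six_of_groupCodes splitPerms_subset_oddPerms isMonomialExtension_fourS4Two.closed_split
      (by decide +kernel) hg

end FirstPair

/-! ### The groups `2³.S₄` and `2³:S₄` -/

section SecondPair

/-- The permutations and signs of `A` and `B`. -/
def gensVII : List (Perm (Fin 7) × Finset (Fin 7)) :=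
  [(c[1, 7, 3] * c[2, 4, 6], {1, 2, 3, 4, 5, 7}), (swap 2 6 * swap 3 5, {2, 3})]

/-- The points of the Fano plane outside the invariant line, as one-element blocks. -/
def tetradPoints : Finset (Finset (Fin 7)) := {{1}, {3}, {5}, {7}}

/-- The permutations of the indices that underlie representatives of the conjugacy classes of
`2³.S₄` and of `2³:S₄`. -/
def cyclesVII : Fin 13 → Perm (Fin 7) :=
  ![1, 1, 1, c[1, 7] * c[3, 5], c[1, 7] * c[2, 6], c[2, 4, 6] * c[3, 7, 5], c[1, 7] * c[3, 5],
    c[1, 7] * c[3, 5], c[1, 7] * c[2, 6], c[1, 7] * c[2, 6], c[1, 7, 3] * c[2, 4, 6],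
    c[1, 7, 3, 5] * c[4, 6], c[1, 7, 3, 5] * c[4, 6]]

/-- Representatives of the conjugacy classes of `2³.S₄`. -/
def repVII (j : Fin 13) : Perm (ℤˣ × Fin 7) :=
  signedPerm (cyclesVII j) (![{}, {1, 3, 5, 7}, {1, 2, 4, 5}, {4, 6}, {3, 4}, {}, {1, 3},
    {2, 3, 6, 7}, {2, 7}, {3, 5, 6, 7}, {1, 5}, {4, 5}, {1, 2}] j)

/-- Representatives of the conjugacy classes of the model of `2³:S₄` by signed permutations. -/
def splitRepVII (j : Fin 13) : Perm (ℤˣ × Fin 7) :=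
  signedPerm (cyclesVII j) (![{}, {1, 3, 5, 7}, {1, 2, 4, 5}, {1, 3, 4, 6}, {4, 5, 6, 7}, {},
    {}, {1, 2, 6, 7}, {}, {1, 3, 5, 7}, {1, 2, 4, 5}, {}, {2, 3, 5, 6}] j)

theorem isMonomialExtension_eightS4 : IsMonomialExtension eightS4 gensVII tetradPoints where
  eq_closure := by
    rw [eightS4]
    congr 1
    ext s
    simp [signedPerms, gensVII, A, B]
  closed := by decide +kernel
  length := by decide +kernel
  le := by decide +kernel
  conj := by decide +kernel
  card_blocks := by decide +kernel
  stabilizes := by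
    intro s hs
    simp only [signedPerms, gensVII, List.map_cons, List.map_nil, List.mem_cons, List.not_mem_nil,
      or_false] at hs
    rcases hs with rfl | rfl <;> (change _ = _; decide +kernel)
  kernel := by decide +kernel
  closed_split := by decide +kernel
  length_split := by decide +kernel

/-- The generators of `2³.S₄`, as well as those of the model of `2³:S₄`, preserve the families
that enter into `invariantsVII`. -/
theorem mem_familyStabilizer_familiesVII : ∀ 𝓕 ∈ familiesVII,
    ∀ s ∈ signedPerms gensVII ++ splitPerms gensVII, s ∈ familyStabilizer 𝓕 := by
  intro 𝓕 h𝓕 s hs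
  simp only [familiesVII, List.mem_cons, List.not_mem_nil, or_false] at h𝓕
  simp only [signedPerms, splitPerms, signChanges, gensVII, List.map_cons, List.map_nil,
    List.mem_append, List.mem_cons, List.not_mem_nil, or_false] at hs
  rcases h𝓕 with rfl | rfl | rfl | rfl | rfl | rfl <;>
    rcases hs with (rfl | rfl) | (rfl | rfl | rfl) | rfl | rfl <;>
    (change _ = _; decide +kernel)

theorem orderOf_repVII (j : Fin 13) : orderOf (repVII j) = ordVIINonsplit j := by
  have h : ∀ j, 0 < ordVIINonsplit j ∧
      (mulCode (code (repVII j)))^[ordVIINonsplit j] (code 1) = code 1 ∧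
      ∀ m < ordVIINonsplit j, 0 < m → (mulCode (code (repVII j)))^[m] (code 1) ≠ code 1 := by
    decide +kernel
  exact orderOf_eq_of_code (signedPerm_mem_oddPerms _ _) (h j).1 (h j).2.1 (h j).2.2

theorem orderOf_splitRepVII (j : Fin 13) : orderOf (splitRepVII j) = ordVIISplit j := by
  have h : ∀ j, 0 < ordVIISplit j ∧
      (mulCode (code (splitRepVII j)))^[ordVIISplit j] (code 1) = code 1 ∧
      ∀ m < ordVIISplit j, 0 < m → (mulCode (code (splitRepVII j)))^[m] (code 1) ≠ code 1 := by
    decide +kernel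
  exact orderOf_eq_of_code (signedPerm_mem_oddPerms _ _) (h j).1 (h j).2.1 (h j).2.2

theorem repVII_mem (j : Fin 13) : repVII j ∈ Subgroup.closure {s | s ∈ signedPerms gensVII} := by
  have h : ∀ j, memCode (code (repVII j)) (groupCodes (signedPerms gensVII)) = true := by
    decide +kernel
  exact mem_closure_of_code_mem signedPerms_subset_oddPerms (signedPerm_mem_oddPerms _ _)
    (memCode_eq_true.1 (h j))

theorem splitRepVII_mem (j : Fin 13) :
    splitRepVII j ∈ Subgroup.closure {s | s ∈ splitPerms gensVII} := by
  have h : ∀ j, memCode (code (splitRepVII j)) (groupCodes (splitPerms gensVII)) = true := by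
    decide +kernel
  exact mem_closure_of_code_mem splitPerms_subset_oddPerms (signedPerm_mem_oddPerms _ _)
    (memCode_eq_true.1 (h j))

theorem hasCharacterTable_eightS4 : HasCharacterTable eightS4 sizeVII ordVIINonsplit tableVII :=
  hasCharacterTable_tableVII (φ := eightS4.subtype) Subtype.val_injective
    (by rw [Subgroup.range_subtype]; exact isMonomialExtension_eightS4.eq_closure)
    signedPerms_subset_oddPerms isMonomialExtension_eightS4.card
    (fun 𝓕 h𝓕 s hs => mem_familyStabilizer_familiesVII 𝓕 h𝓕 s (List.mem_append_left _ hs))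
    repVII_mem (by decide +kernel) (by decide +kernel) orderOf_repVII

theorem hasCharacterTable_splitVersion_eightS4 :
    HasCharacterTable (SplitVersion eightS4) sizeVII ordVIISplit tableVII := by
  obtain ⟨φ, hinj, hrange, -⟩ := isMonomialExtension_eightS4.exists_splitModel
  exact hasCharacterTable_tableVII hinj hrange splitPerms_subset_oddPerms
    isMonomialExtension_eightS4.card_splitVersion
    (fun 𝓕 h𝓕 s hs => mem_familyStabilizer_familiesVII 𝓕 h𝓕 s (List.mem_append_right _ hs))
    splitRepVII_mem (by decide +kernel) (by decide +kernel) orderOf_splitRepVII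

theorem repVII_eleven : repVII 11 ∈ eightS4 ∧ orderOf (repVII 11) = 8 :=
  ⟨isMonomialExtension_eightS4.eq_closure ▸ repVII_mem 11, orderOf_repVII 11⟩

end SecondPair

end OctonionExtensions

open OctonionExtensions in
theorem mainTheorem7 :
    -- the four groups and their extension structure
    (Nat.card fourS4Two = 192 ∧ E ≤ fourS4Two ∧ (E.subgroupOf fourS4Two).Normal ∧
      Nonempty (inducedAut fourS4Two ≃* S4) ∧ IsNonsplitExtension fourS4Two (ElemAb 3) S4 ∧
      HasShapeFourS4Two fourS4Two False) ∧
    (Nat.card (SplitVersion fourS4Two) = 192 ∧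
      IsSplitExtension (SplitVersion fourS4Two) (ElemAb 3) S4 ∧
      HasShapeFourS4Two (SplitVersion fourS4Two) True) ∧
    (Nat.card eightS4 = 192 ∧ E ≤ eightS4 ∧ (E.subgroupOf eightS4).Normal ∧
      Nonempty (inducedAut eightS4 ≃* S4) ∧ IsNonsplitExtension eightS4 (ElemAb 3) S4) ∧
    (Nat.card (SplitVersion eightS4) = 192 ∧
      IsSplitExtension (SplitVersion eightS4) (ElemAb 3) S4) ∧
    -- the shared character table of the first pair
    HasCharacterTable fourS4Two sizeV ordVNonsplit tableV ∧
    HasCharacterTable (SplitVersion fourS4Two) sizeV ordVSplit tableV ∧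
    -- the shared character table of the second pair
    HasCharacterTable eightS4 sizeVII ordVIINonsplit tableVII ∧
    HasCharacterTable (SplitVersion eightS4) sizeVII ordVIISplit tableVII ∧
    -- in each pair the two groups are not isomorphic
    IsEmpty (fourS4Two ≃* SplitVersion fourS4Two) ∧
    IsEmpty (eightS4 ≃* SplitVersion eightS4) := by
  have hV := isMonomialExtension_fourS4Two
  have hVII := isMonomialExtension_eightS4
  exact ⟨⟨hV.card, hV.E_le, hV.normal, hV.nonempty_inducedAut_mulEquiv,
      hV.isNonsplitExtension repV_thirteen.1 repV_thirteen.2.1, hasShapeFourS4Two_fourS4Two⟩,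
    ⟨hV.card_splitVersion, hV.isSplitExtension, hasShapeFourS4Two_splitVersion_fourS4Two⟩,
    ⟨hVII.card, hVII.E_le, hVII.normal, hVII.nonempty_inducedAut_mulEquiv,
      hVII.isNonsplitExtension repVII_eleven.1 repVII_eleven.2⟩,
    ⟨hVII.card_splitVersion, hVII.isSplitExtension⟩,
    hasCharacterTable_fourS4Two, hasCharacterTable_splitVersion_fourS4Two,
    hasCharacterTable_eightS4, hasCharacterTable_splitVersion_eightS4,
    hV.isEmpty_mulEquiv repV_thirteen.1 repV_thirteen.2.1,
    hVII.isEmpty_mulEquiv repVII_eleven.1 repVII_eleven.2⟩
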